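/- Let $d\ge 1$ and let $B_1\subset\mathbb R^d$ be the open unit ball about the origin. Let $\mathcal C_0$ be the class of finite sets $X\subset\mathbb R^d\setminus B_1$ with $|x-y|\ge 1$ for all distinct $x,y\in X$. For a measurable function $f$, considered modulo equality almost everywhere, let $\|f\|=\min\sup_{X\in\mathcal C_0}\sum_{x\in X}|f'(x)|$, the minimum being over the representatives $f'$ of $f$. Let $\mathcal G$ be the set of classes $g$ of real measurable functions such that, for some $a<1$, $g(x)=g(-x)\ge -a$ for almost all $|x|\ge 1$, $g(x)=-1$ for almost all $|x|<1$, and $\|g\|<\infty$. For $c>0$ let $\mathcal G_c=\{g\in\mathcal G:\|g\|\le c\}$. For sequences $\psi=(\psi_m(x_1,\dots,x_m))_{m\ge 0}$ of functions put $(\psi^1*\psi^2)(X)=\sum_{Y\subseteq X}\psi^1(Y)\,\psi^2(X\setminus Y)$, the sum being over all subsequences $Y$ of the finite sequence $X$; the unit is $\mathbf 1=(1,0,0,\dots)$. For $\psi_0=1$ and $\varphi'=\psi-\mathbf 1$ let $\Gamma^{-1}\psi=\varphi'-\frac{\varphi'*\varphi'}{2}+\frac{\varphi'*\varphi'*\varphi'}{3}-\cdots$.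 For $g\in\mathcal G$ the Boltzmann factors are $\psi_m(x_1,\dots,x_m)=\prod_{i<j}(1+g(x_i-x_j))$, $\psi_0=1$, and the Ursell functions are $\varphi=\Gamma^{-1}\psi$. Put $$A(z,g)=\sum_{n\ge 1}\frac{z^{n-1}}{n!}\int_{\mathbb R^{nd}}\varphi_{1+n}(0,y_1,\dots,y_n)\,dy,\qquad B(z,g)(x)=\sum_{n\ge 1}\frac{z^{n-1}}{n!}\int_{\mathbb R^{nd}}\varphi_{2+n}(0,x,y_1,\dots,y_n)\,dy .$$ Given a number $\overline\omega_1$ and a measurable function $\overline\omega_2$, define $Q(z,g)=(z',g')$ by $$z'=\overline\omega_1-z^2A(z,g),\qquad g'(x)=\frac{\overline\omega_2(x)}{z^2}-zB(z,g)(x)\ \text{ for }|x|\ge 1,\qquad g'(x)=-1\ \text{ for }|x|<1 .$$ **Claim.** Let $0<r<1$. There are constants $0<a_1<1$, $a_2>1$, $0<c<1$, $h>0$ and $0\le\kappa<1$ such that for all sufficiently small $z_0>0$ the following holds with $D=[a_1z_0,a_2z_0]\times\mathcal G_c$. For every $(z,g)\in D$ the integrals and the series defining $A(z,g)$ and, for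 almost every $|x|\ge 1$, those defining $B(z,g)(x)$, converge absolutely. Moreover, whenever $$\overline\omega_1=z_0,\quad \overline\omega_2(x)=-\overline\omega_1^2\ \text{ for }|x|<1,\quad \overline\omega_2(x)=\overline\omega_2(-x)\ \text{ for all }x,\quad \sup_{X\in\mathcal C_0}\sum_{x\in X}|\overline\omega_2(x)|\le r\,\overline\omega_1^2,$$ one has: 1. $Q$ maps $D$ into itself; 2. $\rho(Q(z_1,g_1),Q(z_2,g_2))\le\kappa\,\rho((z_1,g_1),(z_2,g_2))$ for all $(z_1,g_1),(z_2,g_2)\in D$, where $\rho((z_1,g_1),(z_2,g_2))=\frac{h|z_1-z_2|}{z_0}+\|g_1-g_2\|$; 3. there is $(z,g)\in D$ with $(z,g)=Q(z,g)$. The bound on $z_0$ does not depend on $\overline\omega_2$. -/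

import Mathlib

open MeasureTheory
open scoped ENNReal NNReal

namespace HardCoreGibbs

/-! ### The algebra of sequences of functions

A sequence `ψ = (ψ_m(x₁, …, x_m))_{m ≥ 0}` is a real function on finite lists of points. -/

/-- All pairs `(Y, X \ Y)` where `Y` is a subsequence of `X` and `X \ Y` is the subsequence that
remains when `Y` is struck out (one pair for each of the `2 ^ m` sets of positions). -/
def splits {α : Type} : List α → List (List α × List α)
  | [] => [([], [])]
  | a :: l =>
      (splits l).map (fun p => (a :: p.1, p.2)) ++ (splits l).map (fun p => (p.1, a :: p.2))

/-- The product `(ψ¹ * ψ²)(X) = ∑_{Y ⊆ X} ψ¹(Y) ψ²(X \ Y)`. -/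
def seqMul {α : Type} (F G : List α → ℝ) (X : List α) : ℝ :=
  ((splits X).map (fun p => F p.1 * G p.2)).sum

/-- The unit element: `1` on the empty sequence and `0` on all others. -/
def seqOne {α : Type} : List α → ℝ
  | [] => 1
  | _ :: _ => 0

/-- The powers `F * ⋯ * F` for the product `seqMul`. -/
def seqPow {α : Type} (F : List α → ℝ) : ℕ → List α → ℝ
  | 0 => seqOne
  | k + 1 => seqMul F (seqPow F k)

/-- `Γ⁻¹(1 + φ') = φ' - φ' * φ' / 2 + φ' * φ' * φ' / 3 - ⋯`, where `φ' = ψ - 1` vanishes on the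
empty sequence. On a sequence of length `m` the powers of order larger than `m` vanish (see
`seqPow_eq_zero`), so the series stops there. -/
noncomputable def gammaInv {α : Type} (ψ : List α → ℝ) (X : List α) : ℝ :=
  ∑ k ∈ Finset.range X.length, (-1 : ℝ) ^ k / ((k : ℝ) + 1) * seqPow (ψ - seqOne) (k + 1) X

lemma length_of_mem_splits {α : Type} (X : List α) :
    ∀ p ∈ splits X, p.1.length + p.2.length = X.length := by
  induction X with
  | nil => intro p hp; simp [splits] at hp; simp [hp]
  | cons a l ih =>
    intro p hp
    simp only [splits, List.mem_append, List.mem_map] at hp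
    rcases hp with ⟨q, hq, rfl⟩ | ⟨q, hq, rfl⟩
    · have := ih q hq
      simp only [List.length_cons]; omega
    · have := ih q hq
      simp only [List.length_cons]; omega

lemma seqPow_eq_zero {α : Type} (F : List α → ℝ) (hF : F [] = 0) (k : ℕ) :
    ∀ X : List α, X.length < k → seqPow F k X = 0 := by
  induction k with
  | zero => intro X hX; omega
  | succ k ih =>
    intro X hX
    simp only [seqPow, seqMul]
    apply List.sum_eq_zero
    intro t ht
    obtain ⟨p, hp, rfl⟩ := List.mem_map.1 ht
    have hlen := length_of_mem_splits X p hp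
    rcases hp1 : p.1 with _ | ⟨a, l⟩
    · rw [hF, zero_mul]
    · rw [hp1, List.length_cons] at hlen
      rw [ih p.2 (by omega), mul_zero]

/-! ### Boltzmann factors and Ursell functions -/

/-- `d`-dimensional Euclidean space. -/
abbrev Pt (d : ℕ) : Type := EuclideanSpace ℝ (Fin d)

/-- The Boltzmann factors `ψ_m(x₁, …, x_m) = e^{-U(x₁, …, x_m)} = ∏_{i < j} (1 + g(x_i - x_j))`,
where `g = e^{-Φ} - 1` and `U(x₁, …, x_m) = ∑_{i < j} Φ(x_i - x_j)`. -/
noncomputable def boltzmann {d : ℕ} (g : Pt d → ℝ) : List (Pt d) → ℝ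
  | [] => 1
  | x :: l => (l.map (fun y => 1 + g (x - y))).prod * boltzmann g l

/-- The Ursell functions `φ = Γ⁻¹ ψ`. -/
noncomputable def ursell {d : ℕ} (g : Pt d → ℝ) : List (Pt d) → ℝ :=
  gammaInv (boltzmann g)

/-- `A(z, g) = ∑_{n ≥ 1} z^{n-1} / n! ∫ φ_{1+n}(0, y₁, …, y_n) dy₁ ⋯ dy_n`, with `n = k + 1`. -/
noncomputable def seriesA {d : ℕ} (z : ℝ) (g : Pt d → ℝ) : ℝ :=
  ∑' k : ℕ, z ^ k / ((k + 1).factorial : ℝ) *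
    ∫ y : Fin (k + 1) → Pt d, ursell g (0 :: List.ofFn y)

/-- `B(z, g)(x) = ∑_{n ≥ 1} z^{n-1} / n! ∫ φ_{2+n}(0, x, y₁, …, y_n) dy₁ ⋯ dy_n`,
with `n = k + 1`. -/
noncomputable def seriesB {d : ℕ} (z : ℝ) (g : Pt d → ℝ) (x : Pt d) : ℝ :=
  ∑' k : ℕ, z ^ k / ((k + 1).factorial : ℝ) *
    ∫ y : Fin (k + 1) → Pt d, ursell g (0 :: x :: List.ofFn y)

/-- The integrals and the series in `A(z, g)` converge absolutely. -/
def ConvergesA {d : ℕ} (z : ℝ) (g : Pt d → ℝ) : Prop :=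
  (∀ k : ℕ, Integrable (fun y : Fin (k + 1) → Pt d => ursell g (0 :: List.ofFn y))) ∧
  Summable (fun k : ℕ => |z| ^ k / ((k + 1).factorial : ℝ) *
    ∫ y : Fin (k + 1) → Pt d, |ursell g (0 :: List.ofFn y)|)

/-- The integrals and the series in `B(z, g)(x)` converge absolutely. -/
def ConvergesB {d : ℕ} (z : ℝ) (g : Pt d → ℝ) (x : Pt d) : Prop :=
  (∀ k : ℕ, Integrable (fun y : Fin (k + 1) → Pt d => ursell g (0 :: x :: List.ofFn y))) ∧
  Summable (fun k : ℕ => |z| ^ k / ((k + 1).factorial : ℝ) *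
    ∫ y : Fin (k + 1) → Pt d, |ursell g (0 :: x :: List.ofFn y)|)

/-! ### The space of functions `g` -/

/-- The class `𝒞₀`: finite sets of points outside the open unit ball around the origin whose
mutual distances are at least `1`. -/
def IsC0 {d : ℕ} (X : Finset (Pt d)) : Prop :=
  (∀ x ∈ X, 1 ≤ ‖x‖) ∧ ∀ x ∈ X, ∀ y ∈ X, x ≠ y → 1 ≤ ‖x - y‖

/-- `sup_{X ∈ 𝒞₀} ∑_{x ∈ X} |f(x)|`, in `[0, ∞]`. -/
noncomputable def supSum {d : ℕ} (f : Pt d → ℝ) : ℝ≥0∞ :=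
  ⨆ (X : Finset (Pt d)) (_ : IsC0 X), ∑ x ∈ X, ENNReal.ofReal |f x|

/-- `‖f‖` for a class `f` of measurable functions modulo equality almost everywhere: the least
value of `sup_{X ∈ 𝒞₀} ∑_{x ∈ X} |f(x)|` over the representatives of the class. -/
noncomputable def cnorm {d : ℕ} (f : Pt d →ₘ[volume] ℝ) : ℝ≥0∞ :=
  ⨅ (f' : Pt d → ℝ) (_ : f' =ᵐ[volume] f), supSum f'

/-- The set `𝒢` of classes `g` with `g(x) = g(-x) ≥ -a > -1` for almost all `|x| ≥ 1`,
`g(x) = -1` for almost all `|x| < 1`, and `‖g‖ < ∞`. -/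
structure IsG {d : ℕ} (g : Pt d →ₘ[volume] ℝ) : Prop where
  even : ∀ᵐ x : Pt d, 1 ≤ ‖x‖ → g x = g (-x)
  lower : ∃ a : ℝ, a < 1 ∧ ∀ᵐ x : Pt d, 1 ≤ ‖x‖ → -a ≤ g x
  core : ∀ᵐ x : Pt d, ‖x‖ < 1 → g x = -1
  finite : cnorm g < ∞

/-- `D = [a₁ z₀, a₂ z₀] × 𝒢_c`, where `𝒢_c = {g ∈ 𝒢 : ‖g‖ ≤ c}`. -/
def domainD (d : ℕ) (a₁ a₂ c z₀ : ℝ) : Set (ℝ × (Pt d →ₘ[volume] ℝ)) :=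
  {p | p.1 ∈ Set.Icc (a₁ * z₀) (a₂ * z₀) ∧ IsG p.2 ∧ cnorm p.2 ≤ ENNReal.ofReal c}

/-- The metric `ρ((z₁, g₁), (z₂, g₂)) = h |z₁ - z₂| / z₀ + ‖g₁ - g₂‖`, with values in `[0, ∞]`
(finite on `D`). -/
noncomputable def rho {d : ℕ} (h z₀ : ℝ) (p q : ℝ × (Pt d →ₘ[volume] ℝ)) : ℝ≥0∞ :=
  ENNReal.ofReal (h * |p.1 - q.1| / z₀) + cnorm (p.2 - q.2)

/-! ### Measurability of `B(z, g)` -/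

lemma seqMul_cons {α : Type} (F G : List α → ℝ) (a : α) (l : List α) :
    seqMul F G (a :: l) = seqMul (fun X => F (a :: X)) G l + seqMul F (fun X => G (a :: X)) l := by
  simp [seqMul, splits, List.map_append, List.sum_append, List.map_map, Function.comp_def]

/-- Joint measurability of a family of sequences of functions. -/
def SeqMeas {d : ℕ} {Ω : Type} [MeasurableSpace Ω] (F : Ω → List (Pt d) → ℝ) : Prop :=
  ∀ m : ℕ, Measurable (fun p : Ω × (Fin m → Pt d) => F p.1 (List.ofFn p.2))

lemma measurable_cons {d m : ℕ} {Ω : Type} [MeasurableSpace Ω] {a : Ω → Pt d}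
    {v : Ω → Fin m → Pt d} (ha : Measurable a) (hv : Measurable v) :
    Measurable (fun w => (Fin.cons (a w) (v w) : Fin (m + 1) → Pt d)) := by
  refine measurable_pi_lambda _ (fun i => ?_)
  refine Fin.cases ?_ (fun j => ?_) i
  · simpa using ha
  · simpa [Function.comp_def] using (measurable_pi_apply j).comp hv

lemma SeqMeas.consArg {d : ℕ} {Ω : Type} [MeasurableSpace Ω] {F : Ω → List (Pt d) → ℝ}
    (hF : SeqMeas F) : SeqMeas (fun (w : Ω × Pt d) X => F w.1 (w.2 :: X)) := by
  intro m
  have h1 : Measurable (fun p : (Ω × Pt d) × (Fin m → Pt d) =>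
      (p.1.1, (Fin.cons p.1.2 p.2 : Fin (m + 1) → Pt d))) :=
    (measurable_fst.comp measurable_fst).prodMk
      (measurable_cons (measurable_snd.comp measurable_fst) measurable_snd)
  have h2 := (hF (m + 1)).comp h1
  simpa [Function.comp_def, List.ofFn_succ] using h2

lemma SeqMeas.weaken {d : ℕ} {Ω : Type} [MeasurableSpace Ω] {F : Ω → List (Pt d) → ℝ}
    (hF : SeqMeas F) : SeqMeas (fun (w : Ω × Pt d) X => F w.1 X) := by
  intro m
  exact (hF m).comp ((measurable_fst.comp measurable_fst).prodMk measurable_snd)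

lemma measurable_seqMul {d : ℕ} (m : ℕ) : ∀ {Ω : Type} [MeasurableSpace Ω]
    {F G : Ω → List (Pt d) → ℝ}, SeqMeas F → SeqMeas G →
    Measurable (fun p : Ω × (Fin m → Pt d) =>
      seqMul (F p.1) (G p.1) (List.ofFn p.2)) := by
  induction m with
  | zero =>
    intro Ω _ F G hF hG
    have h := (hF 0).mul (hG 0)
    simpa [seqMul, splits, Pi.mul_def] using h
  | succ m ih =>
    intro Ω _ F G hF hG
    have h := (ih hF.consArg hG.weaken).add (ih hF.weaken hG.consArg)
    have hm : Measurable (fun p : Ω × (Fin (m + 1) → Pt d) =>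
        ((p.1, p.2 0), (fun i : Fin m => p.2 i.succ))) := by
      refine (measurable_fst.prodMk ((measurable_pi_apply _).comp measurable_snd)).prodMk ?_
      exact measurable_pi_lambda _ (fun i => (measurable_pi_apply _).comp measurable_snd)
    have h2 := h.comp hm
    simpa [Function.comp_def, List.ofFn_succ, seqMul_cons] using h2

lemma measurable_boltzmann {d : ℕ} {g : Pt d → ℝ} (hg : Measurable g) (m : ℕ) :
    Measurable (fun v : Fin m → Pt d => boltzmann g (List.ofFn v)) := by
  induction m with
  | zero => simp [boltzmann]
  | succ m ih =>
    have h1 : Measurable (fun v : Fin (m + 1) → Pt d =>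
        ∏ i : Fin m, (1 + g (v 0 - v i.succ))) := by
      refine Finset.measurable_prod _ (fun i _ => ?_)
      exact measurable_const.add
        (hg.comp ((measurable_pi_apply _).sub (measurable_pi_apply _)))
    have h2 : Measurable (fun v : Fin (m + 1) → Pt d => (fun i : Fin m => v i.succ)) :=
      measurable_pi_lambda _ (fun i => measurable_pi_apply _)
    have h3 := h1.mul (ih.comp h2)
    simpa [Function.comp_def, List.ofFn_succ, boltzmann, List.map_ofFn, List.prod_ofFn,
      Pi.mul_def] using h3

lemma measurable_seqOne {d : ℕ} (m : ℕ) :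
    Measurable (fun v : Fin m → Pt d => seqOne (List.ofFn v)) := by
  cases m with
  | zero => simp [seqOne]
  | succ m => simp [List.ofFn_succ, seqOne]

lemma measurable_ursell {d : ℕ} {g : Pt d → ℝ} (hg : Measurable g) (m : ℕ) :
    Measurable (fun v : Fin m → Pt d => ursell g (List.ofFn v)) := by
  have h0 : SeqMeas (fun (_ : Unit) => boltzmann g - (seqOne : List (Pt d) → ℝ)) := fun m =>
    ((measurable_boltzmann hg m).sub (measurable_seqOne m)).comp measurable_snd
  have hpow : ∀ k, SeqMeas (fun (_ : Unit) => seqPow (boltzmann g - seqOne) k) := by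
    intro k
    induction k with
    | zero => exact fun m => (measurable_seqOne m).comp measurable_snd
    | succ k ih => exact fun m => measurable_seqMul m h0 ih
  simp only [ursell, gammaInv, List.length_ofFn]
  refine Finset.measurable_sum _ (fun k _ => Measurable.const_mul ?_ _)
  exact (hpow (k + 1) m).comp (measurable_const (a := ()) |>.prodMk measurable_id)

lemma measurable_seriesB {d : ℕ} (z : ℝ) {g : Pt d → ℝ} (hg : Measurable g) :
    Measurable (seriesB z g) := by
  unfold seriesB
  refine Measurable.tsum (fun k => Measurable.const_mul ?_ _)
  have h1 : Measurable (fun p : Pt d × (Fin (k + 1) → Pt d) =>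
      (Fin.cons 0 (Fin.cons p.1 p.2 : Fin (k + 2) → Pt d) : Fin (k + 3) → Pt d)) :=
    measurable_cons measurable_const (measurable_cons measurable_fst measurable_snd)
  have h2 := (measurable_ursell hg (k + 3)).comp h1
  have h3 : Measurable (fun p : Pt d × (Fin (k + 1) → Pt d) =>
      ursell g (0 :: p.1 :: List.ofFn p.2)) := by
    have e : ∀ p : Pt d × (Fin (k + 1) → Pt d),
        List.ofFn (Fin.cons 0 (Fin.cons p.1 p.2 : Fin (k + 2) → Pt d) : Fin (k + 3) → Pt d)
          = 0 :: p.1 :: List.ofFn p.2 := by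
      intro p
      rw [List.ofFn_cons, List.ofFn_cons]
    simpa only [Function.comp_def, e] using h2
  exact (h3.stronglyMeasurable.integral_prod_right').measurable

/-! ### The operator `Q` -/

/-- The second component of `Q(z, g)`: `ω₂(x) / z² - z B(z, g)(x)` for `|x| ≥ 1` and `-1` for
`|x| < 1`. -/
noncomputable def nextG {d : ℕ} (ω₂ : Pt d → ℝ) (z : ℝ) (g : Pt d → ℝ) (x : Pt d) : ℝ :=
  open Classical in if 1 ≤ ‖x‖ then ω₂ x / z ^ 2 - z * seriesB z g x else -1

lemma aestronglyMeasurable_nextG {d : ℕ} {ω₂ : Pt d → ℝ} (hω₂ : AEMeasurable ω₂ volume)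
    (z : ℝ) (g : Pt d →ₘ[volume] ℝ) :
    AEStronglyMeasurable (nextG ω₂ z g) (volume : Measure (Pt d)) := by
  classical
  obtain ⟨w, hw, hww⟩ := hω₂
  have hB : Measurable (seriesB z g) := measurable_seriesB z g.measurable
  refine AEMeasurable.aestronglyMeasurable ⟨nextG w z g, ?_, ?_⟩
  · unfold nextG
    exact Measurable.ite (measurableSet_le measurable_const measurable_norm)
      ((hw.div_const _).sub (hB.const_mul _)) measurable_const
  · filter_upwards [hww] with x hx
    simp only [nextG, hx]

/-- The operator `Q(z, g) = (ω₁ - z² A(z, g), ω₂ / z² - z B(z, g))`, the second component being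
`-1` on the open unit ball. -/
noncomputable def opQ {d : ℕ} (ω₁ : ℝ) (ω₂ : Pt d → ℝ) (hω₂ : AEMeasurable ω₂ volume)
    (p : ℝ × (Pt d →ₘ[volume] ℝ)) : ℝ × (Pt d →ₘ[volume] ℝ) :=
  (ω₁ - p.1 ^ 2 * seriesA p.1 p.2,
    AEEqFun.mk (nextG ω₂ p.1 p.2) (aestronglyMeasurable_nextG hω₂ p.1 p.2))

end HardCoreGibbs

open HardCoreGibbs

/-!
The operator `Q` is a contraction because `z₀` is small: the series `A` and `B` are bounded and
Lipschitz continuous in `(z, g)` uniformly on `D`, and they enter `Q` with the factors `z²` and `z`.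
The only term of order one is `ω₂ / z²`, whose norm is at most `r / a₁²`, less than `1` if `a₁` is
close to `1`; its dependence on `z` is absorbed by a large weight `h` in the metric. Since `D` is
complete (`completeSpace_domainSpace`), the fixed point comes from the contraction principle.

The estimates of the series rest on the following points.

* *Algebra.* `D_x (Γ⁻¹ ψ) = ψ⁻¹ * D_x ψ` (`gammaInv_cons`), so the Ursell functions are the values at
  `X = [x]` of the functions `ψ⁻¹ * D_X ψ`, which satisfy the Kirkwood–Salsburg recursion
  (`partialUrsell_cons`). The factor `∏ (1 + g(x - x'))` in the recursion is bounded for separated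
  `X`, where the sums of `|g|` are bounded; for other `X` the functions vanish.

* *Differences.* The recursion uses only sums and products, and so does its majorant. The quantity
  `max |u| |v| + t |u - v|` is subadditive and submultiplicative in the pair `(u, v)`, so the same
  induction, run for a pair of functions `g₁`, `g₂` with `t = 1 / ‖g₁ - g₂‖`, bounds the Ursell
  functions and their Lipschitz constants at once (`ursellSize_cons_le`).

* *Integration.* Sums of `|g|` over translated separated sets are bounded, hence so are its integral
  (by tiling with the lattice `ℤ^d`) and its sums over a configuration `Z`. The induction in
  `iterInt_ursellSize_le` lets every point be integrated over one of several measures with this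
  property. Lebesgue measure for all points gives the bound for `A`; the counting measure of `Z` for
  one point gives the bound for `∑_{x ∈ Z} |B(x)|`.

* *Representatives.* Countably many classes have representatives that are even, equal to `-1` on the
  core, and minimal for the norms of the classes and of all their differences (`exists_reps`); the
  series do not depend on the representative (`seriesA_congr`, `seriesB_congr`).
-/

namespace HardCoreGibbs

/-! ### Splittings of finite sequences and the algebra of sequences -/

section Splits

variable {α β : Type} {M : Type*}

/-- The sum of `F Y (X \ Y)` over all subsequences `Y` of `X`. -/
def splitSum [AddCommMonoid M] (X : List α) (F : List α → List α → M) : M :=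
  ((splits X).map (fun p => F p.1 p.2)).sum

lemma splitSum_nil [AddCommMonoid M] (F : List α → List α → M) :
    splitSum [] F = F [] [] := by
  simp [splitSum, splits]

lemma splitSum_cons [AddCommMonoid M] (a : α) (X : List α) (F : List α → List α → M) :
    splitSum (a :: X) F =
      splitSum X (fun S T => F (a :: S) T) + splitSum X (fun S T => F S (a :: T)) := by
  simp [splitSum, splits, List.map_append, List.sum_append, List.map_map, Function.comp_def]

lemma splitSum_add [AddCommMonoid M] (X : List α) (F G : List α → List α → M) :
    splitSum X (fun S T => F S T + G S T) = splitSum X F + splitSum X G := by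
  simp [splitSum, List.sum_map_add]

lemma splitSum_const_mul {R : Type*} [Semiring R] (X : List α) (c : R) (F : List α → List α → R) :
    splitSum X (fun S T => c * F S T) = c * splitSum X F := by
  simp [splitSum, List.sum_map_mul_left]

lemma splitSum_mul_const {R : Type*} [Semiring R] (X : List α) (c : R) (F : List α → List α → R) :
    splitSum X (fun S T => F S T * c) = splitSum X F * c := by
  simp [splitSum, List.sum_map_mul_right]

lemma splitSum_finset_sum [AddCommMonoid M] {κ : Type*} (s : Finset κ) (X : List α)
    (F : κ → List α → List α → M) :
    splitSum X (fun S T => ∑ k ∈ s, F k S T) = ∑ k ∈ s, splitSum X (F k) := by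
  induction X generalizing F with
  | nil => simp [splitSum_nil]
  | cons a X ih => simp [splitSum_cons, ih, Finset.sum_add_distrib]

lemma splitSum_comm [AddCommMonoid M] (X : List α) (F : List α → List α → M) :
    splitSum X (fun S T => F T S) = splitSum X F := by
  induction X generalizing F with
  | nil => simp [splitSum_nil]
  | cons a X ih =>
    rw [splitSum_cons, splitSum_cons, ih (fun S T => F S (a :: T)),
      ih (fun S T => F (a :: S) T), add_comm]

/-- Splitting a sequence into three parts, one part after the other, in two ways. -/
lemma splitSum_assoc [AddCommMonoid M] (X : List α) (F : List α → List α → List α → M) :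
    splitSum X (fun R T => splitSum T (fun S T' => F R S T')) =
      splitSum X (fun Q T' => splitSum Q (fun R S => F R S T')) := by
  induction X generalizing F with
  | nil => simp [splitSum_nil]
  | cons a X ih =>
    simp only [splitSum_cons, splitSum_add]
    rw [ih (fun R S T => F (a :: R) S T), ih (fun R S T => F R (a :: S) T),
      ih (fun R S T => F R S (a :: T)), add_assoc]

lemma splitSum_left_comm [AddCommMonoid M] (X : List α) (F : List α → List α → List α → M) :
    splitSum X (fun R T => splitSum T (fun S T' => F R S T')) =
      splitSum X (fun S T => splitSum T (fun R T' => F R S T')) := by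
  rw [splitSum_assoc, splitSum_assoc]
  congr 1
  funext Q T
  exact splitSum_comm Q (fun R S => F S R T)

lemma mem_splits_sublist {X : List α} {p : List α × List α} (hp : p ∈ splits X) :
    p.1.Sublist X ∧ p.2.Sublist X ∧ (p.1 ++ p.2).Perm X := by
  induction X generalizing p with
  | nil => simp only [splits, List.mem_singleton] at hp; subst hp; simp
  | cons a X ih =>
    simp only [splits, List.mem_append, List.mem_map] at hp
    rcases hp with ⟨q, hq, rfl⟩ | ⟨q, hq, rfl⟩
    · obtain ⟨h1, h2, h3⟩ := ih hq
      exact ⟨h1.cons_cons a, h2.cons a, by simpa using h3⟩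
    · obtain ⟨h1, h2, h3⟩ := ih hq
      exact ⟨h1.cons a, h2.cons_cons a, List.perm_middle.trans (h3.cons a)⟩

lemma splitSum_congr [AddCommMonoid M] {X : List α} {F G : List α → List α → M}
    (h : ∀ S T, S.Sublist X → T.Sublist X → (S ++ T).Perm X → F S T = G S T) :
    splitSum X F = splitSum X G := by
  unfold splitSum
  congr 1
  refine List.map_congr_left (fun p hp => ?_)
  obtain ⟨h1, h2, h3⟩ := mem_splits_sublist hp
  exact h _ _ h1 h2 h3

lemma splitSum_mono [AddCommMonoid M] [PartialOrder M] [IsOrderedAddMonoid M] {X : List α}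
    {F G : List α → List α → M}
    (h : ∀ S T, S.length + T.length = X.length → F S T ≤ G S T) :
    splitSum X F ≤ splitSum X G := by
  unfold splitSum
  exact List.sum_le_sum (fun p hp => h _ _ (length_of_mem_splits X p hp))

/-- A subset of size `i` of the `n` positions can be chosen in `n.choose i` ways. -/
lemma splitSum_length (X : List α) (f : ℕ → ℕ → ℝ) :
    splitSum X (fun S T => f S.length T.length) =
      ∑ p ∈ Finset.HasAntidiagonal.antidiagonal X.length, (X.length.choose p.1 : ℝ) * f p.1 p.2 := by
  induction X generalizing f with
  | nil => simp [splitSum_nil]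
  | cons a X ih =>
    have h1 := ih (fun i j => f (i + 1) j)
    have h2 := ih (fun i j => f i (j + 1))
    have h3 := Finset.sum_antidiagonal_choose_succ_mul (R := ℝ) f X.length
    simp only [splitSum_cons, List.length_cons, h1, h2, h3]
    rw [add_comm]
    congr 1
    refine Finset.sum_congr rfl (fun p hp => ?_)
    rw [Finset.HasAntidiagonal.mem_antidiagonal] at hp
    rw [Nat.choose_symm_of_eq_add (by omega : X.length = p.1 + p.2)]

lemma seqMul_eq_splitSum (F G : List α → ℝ) (X : List α) :
    seqMul F G X = splitSum X (fun S T => F S * G T) := rfl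

lemma seqMul_comm (F G : List α → ℝ) : seqMul F G = seqMul G F := by
  funext X
  rw [seqMul_eq_splitSum, seqMul_eq_splitSum, ← splitSum_comm]
  simp only [mul_comm]

lemma seqMul_assoc (F G H : List α → ℝ) :
    seqMul (seqMul F G) H = seqMul F (seqMul G H) := by
  funext X
  simp only [seqMul_eq_splitSum, ← splitSum_mul_const, ← splitSum_const_mul]
  rw [splitSum_assoc X (fun R S T => F R * (G S * H T))]
  simp only [mul_assoc]

lemma seqOne_seqMul (F : List α → ℝ) : seqMul seqOne F = F := by
  funext X
  induction X generalizing F with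
  | nil => simp [seqMul_eq_splitSum, splitSum_nil, seqOne]
  | cons a X ih =>
    rw [seqMul_cons]
    have h0 : seqMul (fun Y : List α => seqOne (a :: Y)) F = 0 := by
      funext Y
      simp [seqMul, seqOne]
    simp only [h0, Pi.zero_apply, zero_add]
    exact ih (fun Y => F (a :: Y))

lemma seqMul_seqOne (F : List α → ℝ) : seqMul F seqOne = F := by
  rw [seqMul_comm, seqOne_seqMul]

lemma seqMul_add_right (F G H : List α → ℝ) : seqMul F (G + H) = seqMul F G + seqMul F H := by
  funext X
  simp [seqMul_eq_splitSum, mul_add, splitSum_add]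

/-- The operation `F ↦ F (a :: ·)` is a derivation: the chain rule for powers. -/
lemma seqPow_succ_cons (F : List α → ℝ) (a : α) (k : ℕ) :
    (fun Y => seqPow F (k + 1) (a :: Y)) =
      ((k : ℝ) + 1) • seqMul (seqPow F k) (fun Y => F (a :: Y)) := by
  have hcons : ∀ G H : List α → ℝ, (fun Y => seqMul G H (a :: Y)) =
      seqMul (fun Y => G (a :: Y)) H + seqMul G (fun Y => H (a :: Y)) := by
    intro G H
    funext Y
    rw [seqMul_cons]
    rfl
  induction k with
  | zero =>
    funext Y
    simp [seqPow, seqMul_seqOne, seqOne_seqMul]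
  | succ k ih =>
    have h1 : (fun Y => seqPow F (k + 1 + 1) (a :: Y)) =
        (fun Y => seqMul F (seqPow F (k + 1)) (a :: Y)) := rfl
    have h2 : ∀ (c : ℝ) (G H : List α → ℝ), seqMul G (c • H) = c • seqMul G H := by
      intro c G H
      funext X
      simp [seqMul_eq_splitSum, mul_left_comm, splitSum_const_mul]
    rw [h1, hcons, ih, h2, ← seqMul_assoc, seqMul_comm (fun Y => F (a :: Y))]
    have h3 : seqMul F (seqPow F k) = seqPow F (k + 1) := rfl
    rw [h3]
    push_cast
    rw [add_smul ((k : ℝ) + 1) 1, one_smul, add_comm]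

/-- The inverse of `ψ` for the product `seqMul` when `ψ [] = 1`, given by its Neumann series. -/
noncomputable def seqInv (ψ : List α → ℝ) (X : List α) : ℝ :=
  ∑ k ∈ Finset.range (X.length + 1), (-1 : ℝ) ^ k * seqPow (ψ - seqOne) k X

variable {ψ : List α → ℝ}

lemma sub_seqOne_nil (hψ : ψ [] = 1) : (ψ - seqOne : List α → ℝ) [] = 0 := by
  simp [seqOne, hψ]

/-- On sequences of length at most `n` the Neumann series may be cut off at `n`. -/
lemma seqInv_eq_sum (hψ : ψ [] = 1) {X : List α} {n : ℕ} (hn : X.length ≤ n) :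
    seqInv ψ X = ∑ k ∈ Finset.range (n + 1), (-1 : ℝ) ^ k * seqPow (ψ - seqOne) k X := by
  refine Finset.sum_subset (Finset.range_mono (by omega)) (fun k _ hk => ?_)
  rw [Finset.mem_range, not_lt] at hk
  rw [seqPow_eq_zero _ (sub_seqOne_nil hψ) k X (by omega), mul_zero]

lemma seqMul_seqInv_eq_sum (hψ : ψ [] = 1) (G : List α → ℝ) (X : List α) :
    seqMul (seqInv ψ) G X = ∑ k ∈ Finset.range (X.length + 1),
      (-1 : ℝ) ^ k * seqMul (seqPow (ψ - seqOne) k) G X := by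
  simp only [seqMul_eq_splitSum, ← splitSum_const_mul]
  rw [← splitSum_finset_sum]
  refine splitSum_congr (fun S T hS _ _ => ?_)
  rw [seqInv_eq_sum hψ hS.length_le, Finset.sum_mul]
  simp only [mul_assoc]

lemma seqInv_seqMul (hψ : ψ [] = 1) : seqMul (seqInv ψ) ψ = seqOne := by
  funext X
  have h : ψ = seqOne + (ψ - seqOne) := by simp
  conv_lhs => arg 2; rw [h]
  rw [seqMul_add_right, seqMul_seqOne, Pi.add_apply, seqMul_seqInv_eq_sum hψ]
  have h1 : ∀ k, seqMul (seqPow (ψ - seqOne) k) (ψ - seqOne) X = seqPow (ψ - seqOne) (k + 1) X := by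
    intro k
    rw [seqMul_comm]
    rfl
  simp only [h1, seqInv]
  rw [Finset.sum_range_succ' , Finset.sum_range_succ (n := X.length),
    seqPow_eq_zero _ (sub_seqOne_nil hψ) (X.length + 1) X (by omega)]
  have h2 : ∑ k ∈ Finset.range X.length, (-1 : ℝ) ^ (k + 1) * seqPow (ψ - seqOne) (k + 1) X +
      ∑ k ∈ Finset.range X.length, (-1 : ℝ) ^ k * seqPow (ψ - seqOne) (k + 1) X = 0 := by
    rw [← Finset.sum_add_distrib]
    refine Finset.sum_eq_zero (fun k _ => ?_)
    rw [pow_succ]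
    ring
  have h3 : seqPow (ψ - seqOne) 0 X = seqOne X := rfl
  simp only [pow_zero, one_mul, mul_zero, add_zero, h3]
  linarith

/-- The derivative of the logarithm: `D_a (Γ⁻¹ ψ) = ψ⁻¹ * D_a ψ`. -/
lemma gammaInv_cons (hψ : ψ [] = 1) (a : α) (X : List α) :
    gammaInv ψ (a :: X) = seqMul (seqInv ψ) (fun Y => ψ (a :: Y)) X := by
  rw [seqMul_seqInv_eq_sum hψ]
  simp only [gammaInv, List.length_cons]
  refine Finset.sum_congr rfl (fun k _ => ?_)
  have h := congrFun (seqPow_succ_cons (ψ - seqOne) a k) X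
  have h1 : (fun Y => (ψ - seqOne : List α → ℝ) (a :: Y)) = fun Y => ψ (a :: Y) := by
    funext Y
    simp [seqOne]
  simp only [h1, Pi.smul_apply, smul_eq_mul] at h
  rw [h]
  have : (k : ℝ) + 1 ≠ 0 := by positivity
  field_simp

lemma seqMul_congr {F F' G G' : List α → ℝ} {X : List α}
    (hF : ∀ Y, Y.Sublist X → F Y = F' Y) (hG : ∀ Y, Y.Sublist X → G Y = G' Y) :
    seqMul F G X = seqMul F' G' X := by
  simp only [seqMul_eq_splitSum]
  exact splitSum_congr (fun S T hS hT _ => by rw [hF S hS, hG T hT])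

lemma gammaInv_congr {ψ' : List α → ℝ} {X : List α} (h : ∀ Y, Y.Sublist X → ψ Y = ψ' Y) :
    gammaInv ψ X = gammaInv ψ' X := by
  have hpow : ∀ k, ∀ Y, Y.Sublist X → seqPow (ψ - seqOne) k Y = seqPow (ψ' - seqOne) k Y := by
    intro k
    induction k with
    | zero => exact fun _ _ => rfl
    | succ k ih =>
      intro Y hY
      exact seqMul_congr (fun Z hZ => by simp [h Z (hZ.trans hY)])
        (fun Z hZ => ih Z (hZ.trans hY))
  simp only [gammaInv]
  exact Finset.sum_congr rfl (fun k _ => by rw [hpow _ X (List.Sublist.refl X)])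

end Splits

/-! ### The recursion for the truncated Boltzmann factors -/

section Recursion

variable {d : ℕ} {g : Pt d → ℝ}

lemma boltzmann_cons (g : Pt d → ℝ) (x : Pt d) (X : List (Pt d)) :
    boltzmann g (x :: X) = (X.map (fun y => 1 + g (x - y))).prod * boltzmann g X := rfl

lemma boltzmann_perm (hg : ∀ x, g (-x) = g x) {X Y : List (Pt d)} (h : X.Perm Y) :
    boltzmann g X = boltzmann g Y := by
  induction h with
  | nil => rfl
  | cons x h ih => rw [boltzmann_cons, boltzmann_cons, ih, (h.map _).prod_eq]
  | swap x y l =>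
    simp only [boltzmann_cons, List.map_cons, List.prod_cons]
    rw [← neg_sub x y, hg]
    ring
  | trans _ _ ih1 ih2 => rw [ih1, ih2]

lemma boltzmann_congr {g' : Pt d → ℝ} {X : List (Pt d)}
    (h : X.Pairwise (fun x y => g (x - y) = g' (x - y))) : boltzmann g X = boltzmann g' X := by
  induction X with
  | nil => rfl
  | cons x X ih =>
    rw [List.pairwise_cons] at h
    rw [boltzmann_cons, boltzmann_cons, ih h.2]
    congr 2
    exact List.map_congr_left (fun y hy => by rw [h.1 y hy])

lemma ursell_congr {g' : Pt d → ℝ} {X : List (Pt d)}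
    (h : X.Pairwise (fun x y => g (x - y) = g' (x - y))) : ursell g X = ursell g' X :=
  gammaInv_congr (fun _ hY => boltzmann_congr (h.sublist hY))

/-- The sequences of points whose mutual distances are at least `1`. -/
def Separated (X : List (Pt d)) : Prop := X.Pairwise (fun x y => 1 ≤ ‖x - y‖)

lemma boltzmann_eq_zero (hcore : ∀ x, ‖x‖ < 1 → g x = -1) {X : List (Pt d)}
    (h : ¬ Separated X) : boltzmann g X = 0 := by
  induction X with
  | nil => exact absurd List.Pairwise.nil h
  | cons x X ih =>
    rw [boltzmann_cons]
    by_cases hX : Separated X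
    · have : ∃ y ∈ X, ‖x - y‖ < 1 := by
        by_contra! hc
        exact h (List.pairwise_cons.2 ⟨hc, hX⟩)
      obtain ⟨y, hy, hxy⟩ := this
      rw [List.prod_eq_zero, zero_mul]
      exact List.mem_map.2 ⟨y, hy, by rw [hcore _ hxy]; ring⟩
    · rw [ih hX, mul_zero]

/-- `(ψ⁻¹ * D_X ψ)(Y)`, where `(D_X ψ)(Y) = ψ(X, Y)` and `ψ` are the Boltzmann factors. For
`X = [x]` these are the Ursell functions. -/
noncomputable def partialUrsell (g : Pt d → ℝ) (X Y : List (Pt d)) : ℝ :=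
  seqMul (seqInv (boltzmann g)) (fun T => boltzmann g (X ++ T)) Y

lemma ursell_cons (x : Pt d) (Y : List (Pt d)) :
    ursell g (x :: Y) = partialUrsell g [x] Y :=
  gammaInv_cons rfl x Y

lemma partialUrsell_nil (Y : List (Pt d)) : partialUrsell g [] Y = seqOne Y := by
  have h := seqInv_seqMul (ψ := boltzmann g) rfl
  exact congrFun h Y

lemma partialUrsell_eq_zero (hcore : ∀ x, ‖x‖ < 1 → g x = -1) {X : List (Pt d)}
    (h : ¬ Separated X) (Y : List (Pt d)) : partialUrsell g X Y = 0 := by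
  have h0 : ∀ T, boltzmann g (X ++ T) = 0 := fun T =>
    boltzmann_eq_zero hcore (fun hXT => h (hXT.sublist (List.sublist_append_left X T)))
  simp [partialUrsell, h0, seqMul]

lemma prod_one_add_eq_splitSum (f : Pt d → ℝ) (Y : List (Pt d)) :
    (Y.map (fun y => 1 + f y)).prod = splitSum Y (fun S _ => (S.map f).prod) := by
  induction Y with
  | nil => simp [splitSum_nil]
  | cons y Y ih =>
    simp only [List.map_cons, List.prod_cons, splitSum_cons, splitSum_const_mul, ih]
    ring

/-- The Kirkwood–Salsburg recursion. It lowers the total number of points by one. -/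
lemma partialUrsell_cons (hg : ∀ x, g (-x) = g x) (x : Pt d) (X Y : List (Pt d)) :
    partialUrsell g (x :: X) Y = (X.map (fun y => 1 + g (x - y))).prod *
      splitSum Y (fun S T => (S.map (fun s => g (x - s))).prod * partialUrsell g (X ++ S) T) := by
  simp only [partialUrsell, seqMul_eq_splitSum, ← splitSum_const_mul]
  rw [← splitSum_left_comm]
  refine splitSum_congr (fun R T _ _ _ => ?_)
  rw [List.cons_append, boltzmann_cons, List.map_append, List.prod_append,
    prod_one_add_eq_splitSum (fun s => g (x - s)) T, mul_assoc, ← splitSum_mul_const,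
    ← splitSum_const_mul, ← splitSum_const_mul]
  refine splitSum_congr (fun S T' _ _ hST => ?_)
  have hp : (X ++ S ++ T').Perm (X ++ T) := by
    rw [List.append_assoc]
    exact hST.append_left X
  rw [boltzmann_perm hg hp]
  ring

end Recursion

/-! ### A submultiplicative size for pairs of numbers -/

/-- The size `max |u| |v| + t |u - v|` of a pair of numbers. It is submultiplicative, so that an
estimate of the Ursell functions that only uses sums and products gives at the same time an
estimate of the difference of the Ursell functions of two potentials. -/
noncomputable def pairSize (t u v : ℝ) : ℝ := max |u| |v| + t * |u - v|

section PairSize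

variable {t : ℝ}

lemma pairSize_nonneg (ht : 0 ≤ t) (u v : ℝ) : 0 ≤ pairSize t u v := by
  unfold pairSize
  positivity

lemma mul_abs_sub_le_pairSize (u v : ℝ) : t * |u - v| ≤ pairSize t u v := by
  have h1 : 0 ≤ max |u| |v| := le_max_of_le_left (abs_nonneg u)
  unfold pairSize
  linarith

lemma pairSize_le (u v : ℝ) : pairSize t u v ≤ |u| + |v| + t * |u - v| := by
  have := max_le_add_of_nonneg (abs_nonneg u) (abs_nonneg v)
  unfold pairSize
  linarith

lemma pairSize_self (u : ℝ) : pairSize t u u = |u| := by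
  simp [pairSize]

lemma pairSize_add (ht : 0 ≤ t) (u v u' v' : ℝ) :
    pairSize t (u + u') (v + v') ≤ pairSize t u v + pairSize t u' v' := by
  have h1 : max |u + u'| |v + v'| ≤ max |u| |v| + max |u'| |v'| :=
    max_le ((abs_add_le u u').trans (add_le_add (le_max_left _ _) (le_max_left _ _)))
      ((abs_add_le v v').trans (add_le_add (le_max_right _ _) (le_max_right _ _)))
  have h2 : |u + u' - (v + v')| ≤ |u - v| + |u' - v'| := by
    rw [add_sub_add_comm]
    exact abs_add_le _ _
  have h3 := mul_le_mul_of_nonneg_left h2 ht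
  unfold pairSize
  linarith

lemma pairSize_mul (ht : 0 ≤ t) (u v u' v' : ℝ) :
    pairSize t (u * u') (v * v') ≤ pairSize t u v * pairSize t u' v' := by
  have hM : 0 ≤ max |u| |v| := le_max_of_le_left (abs_nonneg u)
  have hM' : 0 ≤ max |u'| |v'| := le_max_of_le_left (abs_nonneg u')
  have h1 : max |u * u'| |v * v'| ≤ max |u| |v| * max |u'| |v'| := by
    rw [abs_mul, abs_mul]
    exact max_le (mul_le_mul (le_max_left _ _) (le_max_left _ _) (abs_nonneg _) hM)
      (mul_le_mul (le_max_right _ _) (le_max_right _ _) (abs_nonneg _) hM)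
  have h2 : |u * u' - v * v'| ≤ |u - v| * max |u'| |v'| + max |u| |v| * |u' - v'| := by
    have : u * u' - v * v' = (u - v) * u' + v * (u' - v') := by ring
    rw [this]
    refine (abs_add_le _ _).trans ?_
    rw [abs_mul, abs_mul]
    gcongr
    · exact le_max_left _ _
    · exact le_max_right _ _
  have h3 := mul_le_mul_of_nonneg_left h2 ht
  have h4 : 0 ≤ (t * |u - v|) * (t * |u' - v'|) := by positivity
  unfold pairSize
  nlinarith

lemma pairSize_list_prod (ht : 0 ≤ t) {α : Type} (f₁ f₂ : α → ℝ) (X : List α) :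
    pairSize t (X.map f₁).prod (X.map f₂).prod ≤
      (X.map (fun x => pairSize t (f₁ x) (f₂ x))).prod := by
  induction X with
  | nil => simp [pairSize]
  | cons x X ih =>
    simp only [List.map_cons, List.prod_cons]
    exact (pairSize_mul ht _ _ _ _).trans
      (mul_le_mul_of_nonneg_left ih (pairSize_nonneg ht _ _))

lemma pairSize_splitSum (ht : 0 ≤ t) {α : Type} (X : List α) (F₁ F₂ : List α → List α → ℝ) :
    pairSize t (splitSum X F₁) (splitSum X F₂) ≤
      splitSum X (fun S T => pairSize t (F₁ S T) (F₂ S T)) := by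
  induction X generalizing F₁ F₂ with
  | nil => simp [splitSum_nil]
  | cons x X ih =>
    simp only [splitSum_cons]
    exact (pairSize_add ht _ _ _ _).trans (add_le_add (ih _ _) (ih _ _))

end PairSize

/-! ### Sums over separated configurations -/

section Weights

variable {d : ℕ}

lemma supSum_le_ofReal_iff {f : Pt d → ℝ} {C : ℝ} (hC : 0 ≤ C) :
    supSum f ≤ ENNReal.ofReal C ↔ ∀ X : Finset (Pt d), IsC0 X → ∑ x ∈ X, |f x| ≤ C := by
  simp only [supSum, iSup_le_iff]
  refine forall₂_congr (fun X _ => ?_)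
  rw [← ENNReal.ofReal_sum_of_nonneg (fun x _ => abs_nonneg _), ENNReal.ofReal_le_ofReal_iff hC]

lemma isC0_singleton {x : Pt d} (hx : 1 ≤ ‖x‖) : IsC0 {x} := by
  refine ⟨fun y hy => ?_, fun y hy z hz hyz => ?_⟩
  · rw [Finset.mem_singleton.1 hy]
    exact hx
  · rw [Finset.mem_singleton.1 hy, Finset.mem_singleton.1 hz] at hyz
    exact absurd rfl hyz

/-- A weight majorizes the size of `g`: it is at most `1` on the core, and its sums over
configurations of the class `𝒞₀` are at most `3`. -/
structure IsWeight (γ : Pt d → ℝ) : Prop where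
  meas : Measurable γ
  nonneg : ∀ x, 0 ≤ γ x
  core_le : ∀ x, ‖x‖ < 1 → γ x ≤ 1
  sum_le : ∀ X : Finset (Pt d), IsC0 X → ∑ x ∈ X, γ x ≤ 3

variable {γ : Pt d → ℝ}

/-- Sums of a weight over translated separated configurations: at most `5 ^ d` points lie in the
core around `x`, and the others form a configuration of the class `𝒞₀` seen from `x`. -/
lemma IsWeight.sum_sub_le (hγ : IsWeight γ) (x : Pt d) (Z : Finset (Pt d))
    (hZ : ∀ y ∈ Z, ∀ z ∈ Z, y ≠ z → 1 ≤ ‖y - z‖) :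
    ∑ z ∈ Z, γ (x - z) ≤ 5 ^ d + 3 := by
  classical
  have hinj : Function.Injective (fun z : Pt d => x - z) := sub_right_injective
  rw [← Finset.sum_filter_add_sum_filter_not Z (fun z => ‖x - z‖ < 1)]
  refine add_le_add ?_ ?_
  · have hcard : ((Z.filter (fun z => ‖x - z‖ < 1)).image (fun z => x - z)).card ≤
        5 ^ Module.finrank ℝ (Pt d) := by
      refine Besicovitch.card_le_of_separated _ ?_ ?_
      · intro c hc
        obtain ⟨z, hz, rfl⟩ := Finset.mem_image.1 hc
        linarith [(Finset.mem_filter.1 hz).2]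
      · intro c hc e he hce
        obtain ⟨z, hz, rfl⟩ := Finset.mem_image.1 hc
        obtain ⟨w, hw, rfl⟩ := Finset.mem_image.1 he
        have := hZ w (Finset.mem_filter.1 hw).1 z (Finset.mem_filter.1 hz).1
          (fun h => hce (by rw [h]))
        simpa using this
    rw [Finset.card_image_of_injective _ hinj, finrank_euclideanSpace_fin] at hcard
    calc ∑ z ∈ Z.filter (fun z => ‖x - z‖ < 1), γ (x - z)
        ≤ ∑ z ∈ Z.filter (fun z => ‖x - z‖ < 1), (1 : ℝ) :=
          Finset.sum_le_sum (fun z hz => hγ.core_le _ (Finset.mem_filter.1 hz).2)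
      _ = ((Z.filter (fun z => ‖x - z‖ < 1)).card : ℝ) := by simp
      _ ≤ 5 ^ d := by exact_mod_cast hcard
  · rw [← Finset.sum_image (f := γ) (g := fun z => x - z) hinj.injOn]
    refine hγ.sum_le _ ⟨fun y hy => ?_, fun y hy w hw hyw => ?_⟩
    · obtain ⟨z, hz, rfl⟩ := Finset.mem_image.1 hy
      exact not_lt.1 (Finset.mem_filter.1 hz).2
    · obtain ⟨z, hz, rfl⟩ := Finset.mem_image.1 hy
      obtain ⟨v, hv, rfl⟩ := Finset.mem_image.1 hw
      have := hZ v (Finset.mem_filter.1 hv).1 z (Finset.mem_filter.1 hz).1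
        (fun h => hyw (by rw [h]))
      simpa using this

lemma IsWeight.list_sum_le (hγ : IsWeight γ) {x : Pt d} {X : List (Pt d)}
    (h : Separated (x :: X)) : (X.map (fun y => γ (x - y))).sum ≤ 3 := by
  classical
  obtain ⟨h1, h2⟩ := List.pairwise_cons.1 h
  have hnd : X.Nodup := h2.imp (fun {a b} hab => by
    rintro rfl
    rw [sub_self, norm_zero] at hab
    linarith)
  have hinj : Function.Injective (fun z : Pt d => x - z) := sub_right_injective
  have hsym : ∀ y ∈ X, ∀ z ∈ X, y ≠ z → 1 ≤ ‖y - z‖ := by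
    intro y hy z hz hyz
    exact List.Pairwise.forall_of_forall_of_flip (R := fun y z : Pt d => y ≠ z → 1 ≤ ‖y - z‖)
      (fun y _ hne => absurd rfl hne) (h2.imp (fun {a b} hab (_ : a ≠ b) => hab))
      (h2.imp (fun {a b} hab (_ : b ≠ a) => by rw [norm_sub_rev]; exact hab)) hy hz hyz
  rw [← List.sum_toFinset _ hnd, ← Finset.sum_image (f := γ) (g := fun z => x - z) hinj.injOn]
  refine hγ.sum_le _ ⟨fun y hy => ?_, fun y hy w hw hyw => ?_⟩
  · obtain ⟨z, hz, rfl⟩ := Finset.mem_image.1 hy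
    exact h1 z (List.mem_toFinset.1 hz)
  · obtain ⟨z, hz, rfl⟩ := Finset.mem_image.1 hy
    obtain ⟨v, hv, rfl⟩ := Finset.mem_image.1 hw
    have := hsym v (List.mem_toFinset.1 hv) z (List.mem_toFinset.1 hz)
      (fun h => hyw (by rw [h]))
    simpa using this

/-- The basis of the lattice `ℤ^d`. -/
noncomputable abbrev cubicBasis (d : ℕ) : Module.Basis (Fin d) ℝ (Pt d) :=
  (EuclideanSpace.basisFun (Fin d) ℝ).toBasis

lemma one_le_norm_of_mem_lattice {v : Pt d}
    (hv : v ∈ Submodule.span ℤ (Set.range (cubicBasis d))) (h0 : v ≠ 0) : 1 ≤ ‖v‖ := by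
  rw [Module.Basis.mem_span_iff_repr_mem] at hv
  have : ∃ i, v i ≠ 0 := by
    by_contra! hc
    exact h0 (by ext i; simpa using hc i)
  obtain ⟨i, hi⟩ := this
  obtain ⟨n, hn⟩ := hv i
  have hn' : (n : ℝ) = v i := by simpa using hn
  have hn0 : n ≠ 0 := by
    rintro rfl
    exact hi (by rw [← hn']; simp)
  have h1 : (1 : ℝ) ≤ |(n : ℝ)| := by exact_mod_cast Int.one_le_abs hn0
  calc (1 : ℝ) ≤ ‖v i‖ := by rw [Real.norm_eq_abs, ← hn']; exact h1
    _ ≤ ‖v‖ := PiLp.norm_apply_le v i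

/-- The bound on the integral of a weight: the points of `ℤ^d` have mutual distances at least
`1`, and `ℝ^d` is tiled by the translates of a bounded cell. -/
noncomputable def weightBound (d : ℕ) : ℝ≥0∞ :=
  (5 ^ d + 3) * max 1 (volume (ZSpan.fundamentalDomain (cubicBasis d)))

lemma weightBound_lt_top (d : ℕ) : weightBound d < ∞ := by
  refine ENNReal.mul_lt_top (by simp) (max_lt (by simp) ?_)
  exact (ZSpan.fundamentalDomain_isBounded _).measure_lt_top

lemma tsum_le_of_forall_finset_sum_le {ι : Type*} {f : ι → ℝ≥0∞} {C : ℝ≥0∞}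
    (h : ∀ s : Finset ι, ∑ i ∈ s, f i ≤ C) : ∑' i, f i ≤ C := by
  rw [ENNReal.tsum_eq_iSup_sum]
  exact iSup_le h

lemma IsWeight.ofReal_sum_sub_le (hγ : IsWeight γ) (x : Pt d) (Z : Finset (Pt d))
    (hZ : ∀ y ∈ Z, ∀ z ∈ Z, y ≠ z → 1 ≤ ‖y - z‖) :
    ∑ z ∈ Z, ENNReal.ofReal (γ (x - z)) ≤ 5 ^ d + 3 := by
  rw [← ENNReal.ofReal_sum_of_nonneg (fun z _ => hγ.nonneg _)]
  refine (ENNReal.ofReal_le_ofReal (hγ.sum_sub_le x Z hZ)).trans (le_of_eq ?_)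
  rw [ENNReal.ofReal_add (by positivity) (by positivity), ENNReal.ofReal_pow (by positivity)]
  simp

lemma IsWeight.sum_sub_le_weightBound (hγ : IsWeight γ) (x : Pt d) (Z : Finset (Pt d))
    (hZ : ∀ y ∈ Z, ∀ z ∈ Z, y ≠ z → 1 ≤ ‖y - z‖) :
    ∑ z ∈ Z, ENNReal.ofReal (γ (x - z)) ≤ weightBound d :=
  (hγ.ofReal_sum_sub_le x Z hZ).trans (le_mul_of_one_le_right (by simp) (le_max_left _ _))

lemma IsWeight.lintegral_sub_le (hγ : IsWeight γ) (x : Pt d) :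
    ∫⁻ y, ENNReal.ofReal (γ (x - y)) ≤ weightBound d := by
  classical
  set L := (Submodule.span ℤ (Set.range (cubicBasis d))).toAddSubgroup
  have hfd := ZSpan.isAddFundamentalDomain' (cubicBasis d) (volume : Measure (Pt d))
  have : Countable L :=
    inferInstanceAs (Countable (Submodule.span ℤ (Set.range (cubicBasis d))))
  rw [hfd.lintegral_eq_tsum'']
  have hm : ∀ v : L, Measurable (fun y => ENNReal.ofReal (γ (x - (v +ᵥ y)))) := fun v => by
    have : Measurable (fun y => x - ((v : Pt d) + y)) := by fun_prop
    exact ENNReal.measurable_ofReal.comp (hγ.meas.comp this)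
  rw [← lintegral_tsum (fun v => (hm _).aemeasurable)]
  calc ∫⁻ y in ZSpan.fundamentalDomain (cubicBasis d),
        ∑' v : L, ENNReal.ofReal (γ (x - (v +ᵥ y)))
      ≤ ∫⁻ _ in ZSpan.fundamentalDomain (cubicBasis d), (5 ^ d + 3) := by
        refine lintegral_mono (fun y => tsum_le_of_forall_finset_sum_le (fun s => ?_))
        have hinj : Function.Injective
            (fun v : L => v +ᵥ y) := by
          intro v w hvw
          exact Subtype.ext (add_right_cancel hvw)
        rw [← Finset.sum_image (f := fun z => ENNReal.ofReal (γ (x - z)))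
          (g := fun v : L => v +ᵥ y) hinj.injOn]
        refine hγ.ofReal_sum_sub_le x _ (fun z hz w hw hzw => ?_)
        obtain ⟨v, _, rfl⟩ := Finset.mem_image.1 hz
        obtain ⟨u, _, rfl⟩ := Finset.mem_image.1 hw
        have h1 : (v +ᵥ y) - (u +ᵥ y) = ((v - u : L) :
            Pt d) := by
          simp [AddSubgroup.vadd_def]
        rw [h1]
        refine one_le_norm_of_mem_lattice (v - u).2 (fun h => hzw ?_)
        rw [← sub_eq_zero, h1, h]
    _ ≤ weightBound d := by
        rw [setLIntegral_const]
        exact mul_le_mul_right (le_max_right _ _) _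

end Weights

/-! ### The pointwise majorant of the truncated Boltzmann factors -/

section Majorant

variable {d : ℕ} {f f₁ f₂ : Pt d → ℝ} {t : ℝ}

/-- Everywhere defined functions that represent the classes of norm at most `1`, with the symmetry
and the hard core holding at every point. -/
structure IsRep (f : Pt d → ℝ) : Prop where
  meas : Measurable f
  even : ∀ x, f (-x) = f x
  core : ∀ x, ‖x‖ < 1 → f x = -1
  sum_le : ∀ X : Finset (Pt d), IsC0 X → ∑ x ∈ X, |f x| ≤ 1

/-- The size, with parameter `t`, of the pair `(φ₁(Y), φ₂(Y))`, where `φᵢ = ψᵢ⁻¹ * D_X ψᵢ` for the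
Boltzmann factors `ψᵢ` of `fᵢ`. -/
noncomputable def ursellSize (t : ℝ) (f₁ f₂ : Pt d → ℝ) (X Y : List (Pt d)) : ℝ :=
  pairSize t (partialUrsell f₁ X Y) (partialUrsell f₂ X Y)

lemma IsRep.isWeight (h₁ : IsRep f₁) (h₂ : IsRep f₂) (ht : 0 ≤ t)
    (hd : ∀ X : Finset (Pt d), IsC0 X → ∑ x ∈ X, t * |f₁ x - f₂ x| ≤ 1) :
    IsWeight (fun x => pairSize t (f₁ x) (f₂ x)) where
  meas := by
    have := h₁.meas
    have := h₂.meas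
    unfold pairSize
    fun_prop
  nonneg x := pairSize_nonneg ht _ _
  core_le x hx := by simp [h₁.core x hx, h₂.core x hx, pairSize]
  sum_le X hX := by
    calc ∑ x ∈ X, pairSize t (f₁ x) (f₂ x)
        ≤ ∑ x ∈ X, (|f₁ x| + |f₂ x| + t * |f₁ x - f₂ x|) :=
          Finset.sum_le_sum (fun x _ => pairSize_le _ _)
      _ ≤ 3 := by
          rw [Finset.sum_add_distrib, Finset.sum_add_distrib]
          linarith [h₁.sum_le X hX, h₂.sum_le X hX, hd X hX]

lemma ursellSize_cons_le (h₁ : IsRep f₁) (h₂ : IsRep f₂) (ht : 0 ≤ t)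
    (hd : ∀ X : Finset (Pt d), IsC0 X → ∑ x ∈ X, t * |f₁ x - f₂ x| ≤ 1)
    (x : Pt d) (X Y : List (Pt d)) :
    ursellSize t f₁ f₂ (x :: X) Y ≤ Real.exp 3 * splitSum Y (fun S T =>
      (S.map (fun s => pairSize t (f₁ (x - s)) (f₂ (x - s)))).prod *
        ursellSize t f₁ f₂ (X ++ S) T) := by
  have hW := h₁.isWeight h₂ ht hd
  have hprod : ∀ S : List (Pt d),
      0 ≤ (S.map (fun s => pairSize t (f₁ (x - s)) (f₂ (x - s)))).prod := fun S =>
    List.prod_nonneg (by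
      intro a ha
      obtain ⟨s, _, rfl⟩ := List.mem_map.1 ha
      exact hW.nonneg _)
  have hsum : pairSize t
      (splitSum Y (fun S T => (S.map (fun s => f₁ (x - s))).prod * partialUrsell f₁ (X ++ S) T))
      (splitSum Y (fun S T => (S.map (fun s => f₂ (x - s))).prod * partialUrsell f₂ (X ++ S) T)) ≤
      splitSum Y (fun S T =>
        (S.map (fun s => pairSize t (f₁ (x - s)) (f₂ (x - s)))).prod *
          ursellSize t f₁ f₂ (X ++ S) T) := by
    refine (pairSize_splitSum ht _ _ _).trans (splitSum_mono (fun S T _ => ?_))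
    refine (pairSize_mul ht _ _ _ _).trans ?_
    exact mul_le_mul_of_nonneg_right (pairSize_list_prod ht _ _ S) (pairSize_nonneg ht _ _)
  by_cases hX : Separated (x :: X)
  · unfold ursellSize
    rw [partialUrsell_cons h₁.even, partialUrsell_cons h₂.even]
    refine (pairSize_mul ht _ _ _ _).trans (mul_le_mul ?_ hsum (pairSize_nonneg ht _ _)
      (Real.exp_nonneg 3))
    refine (pairSize_list_prod ht _ _ X).trans ?_
    have hexp : ∀ y, pairSize t (1 + f₁ (x - y)) (1 + f₂ (x - y)) ≤
        Real.exp (pairSize t (f₁ (x - y)) (f₂ (x - y))) := by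
      intro y
      refine (pairSize_add ht _ _ _ _).trans ?_
      rw [pairSize_self, abs_one, add_comm]
      exact Real.add_one_le_exp _
    calc (X.map (fun y => pairSize t (1 + f₁ (x - y)) (1 + f₂ (x - y)))).prod
        ≤ (X.map (fun y => Real.exp (pairSize t (f₁ (x - y)) (f₂ (x - y))))).prod :=
          List.prod_map_le_prod_map₀ _ _ (fun y _ => pairSize_nonneg ht _ _) (fun y _ => hexp y)
      _ = Real.exp ((X.map (fun y => pairSize t (f₁ (x - y)) (f₂ (x - y)))).sum) := by
          rw [Real.exp_list_sum, List.map_map]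
          rfl
      _ ≤ Real.exp 3 := Real.exp_le_exp.2 (hW.list_sum_le hX)
  · have h0 : ursellSize t f₁ f₂ (x :: X) Y = 0 := by
      simp [ursellSize, partialUrsell_eq_zero h₁.core hX, partialUrsell_eq_zero h₂.core hX,
        pairSize]
    rw [h0]
    exact mul_nonneg (Real.exp_nonneg 3) ((pairSize_nonneg ht _ _).trans hsum)

end Majorant

/-! ### Iterated integrals over finite sequences of points -/

section IterInt

variable {d : ℕ} {ι : Type}

/-- Measurability of a nonnegative function of finite sequences of points that depends on a
parameter. -/
def ParamMeas {Ω : Type} [MeasurableSpace Ω] (F : Ω → List (Pt d) → ℝ≥0∞) : Prop :=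
  ∀ n : ℕ, Measurable (fun p : Ω × (Fin n → Pt d) => F p.1 (List.ofFn p.2))

/-- Measurability of a nonnegative function of finite sequences of points. -/
def ListMeas (f : List (Pt d) → ℝ≥0∞) : Prop :=
  ∀ n : ℕ, Measurable (fun v : Fin n → Pt d => f (List.ofFn v))

/-- Measurability of a nonnegative function of two finite sequences of points. -/
def PairMeas (F : List (Pt d) → List (Pt d) → ℝ≥0∞) : Prop :=
  ∀ m : ℕ, ParamMeas (fun (u : Fin m → Pt d) T => F (List.ofFn u) T)

section Meas

variable {Ω Ω' : Type} [MeasurableSpace Ω] [MeasurableSpace Ω'] {F : Ω → List (Pt d) → ℝ≥0∞}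

lemma ParamMeas.comp (hF : ParamMeas F) {φ : Ω' → Ω} (hφ : Measurable φ) :
    ParamMeas (fun w => F (φ w)) := fun n =>
  (hF n).comp ((hφ.comp measurable_fst).prodMk measurable_snd)

lemma ParamMeas.listMeas (hF : ParamMeas F) (w : Ω) : ListMeas (F w) := fun n =>
  (hF n).comp measurable_prodMk_left

lemma ParamMeas.cons (hF : ParamMeas F) :
    ParamMeas (fun (w : Ω × Pt d) Y => F w.1 (w.2 :: Y)) := by
  intro n
  have h1 : Measurable (fun p : (Ω × Pt d) × (Fin n → Pt d) =>
      (p.1.1, (Fin.cons p.1.2 p.2 : Fin (n + 1) → Pt d))) :=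
    (measurable_fst.comp measurable_fst).prodMk
      (measurable_cons (measurable_snd.comp measurable_fst) measurable_snd)
  have h2 := (hF (n + 1)).comp h1
  simpa [Function.comp_def, List.ofFn_succ] using h2

lemma ListMeas.cons {f : List (Pt d) → ℝ≥0∞} (hf : ListMeas f) :
    ParamMeas (fun (y : Pt d) Y => f (y :: Y)) := by
  have h : ParamMeas (fun (_ : Unit) Y => f Y) := fun n => (hf n).comp measurable_snd
  exact h.cons.comp (φ := fun y => ((), y)) (by fun_prop)

lemma PairMeas.right {F : List (Pt d) → List (Pt d) → ℝ≥0∞} (hF : PairMeas F) (S : List (Pt d)) :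
    ListMeas (F S) := by
  have h := (hF S.length).listMeas S.get
  simpa using h

lemma PairMeas.consLeft {F : List (Pt d) → List (Pt d) → ℝ≥0∞} (hF : PairMeas F) (m : ℕ) :
    ParamMeas (fun (w : Pt d × (Fin m → Pt d)) T => F (w.1 :: List.ofFn w.2) T) := by
  have h := (hF (m + 1)).comp
    (φ := fun w : Pt d × (Fin m → Pt d) => (Fin.cons w.1 w.2 : Fin (m + 1) → Pt d))
    (measurable_cons measurable_fst measurable_snd)
  simpa [List.ofFn_succ] using h

lemma PairMeas.consRight {F : List (Pt d) → List (Pt d) → ℝ≥0∞} (hF : PairMeas F) (m : ℕ) :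
    ParamMeas (fun (w : Pt d × (Fin m → Pt d)) T => F (List.ofFn w.2) (w.1 :: T)) :=
  (hF m).cons.comp (φ := fun w : Pt d × (Fin m → Pt d) => (w.2, w.1)) measurable_swap

end Meas

/-- The integral of `f(y₁, …, y_n)`, the point `y_j` being integrated over `ν_{i_j}`, for the
sequence of indices `i₁, …, i_n`. -/
noncomputable def iterInt (ν : ι → Measure (Pt d)) :
    List ι → (List (Pt d) → ℝ≥0∞) → ℝ≥0∞
  | [], f => f []
  | i :: M, f => ∫⁻ y, iterInt ν M (fun Y => f (y :: Y)) ∂ν i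

variable (ν : ι → Measure (Pt d))

lemma iterInt_mono (M : List ι) {f g : List (Pt d) → ℝ≥0∞}
    (h : ∀ Y, Y.length = M.length → f Y ≤ g Y) : iterInt ν M f ≤ iterInt ν M g := by
  induction M generalizing f g with
  | nil => exact h [] rfl
  | cons i M ih => exact lintegral_mono (fun y => ih (fun Y hY => h _ (by simp [hY])))

lemma iterInt_const_mul (M : List ι) {c : ℝ≥0∞} (hc : c ≠ ∞) (f : List (Pt d) → ℝ≥0∞) :
    iterInt ν M (fun Y => c * f Y) = c * iterInt ν M f := by
  induction M generalizing f with
  | nil => rfl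
  | cons i M ih =>
    simp only [iterInt, ih]
    rw [lintegral_const_mul' _ _ hc]

lemma iterInt_prod_mul_le (M : List ι) {w : Pt d → ℝ≥0∞} (hw : ∀ y, w y ≠ ∞)
    (hwm : Measurable w) {G : ℝ≥0∞} (hG : ∀ i, ∫⁻ y, w y ∂ν i ≤ G) (C : ℝ≥0∞) :
    iterInt ν M (fun S => (S.map w).prod * C) ≤ G ^ M.length * C := by
  induction M with
  | nil => simp [iterInt]
  | cons i M ih =>
    simp only [iterInt, List.map_cons, List.prod_cons, mul_assoc, List.length_cons]
    calc ∫⁻ y, iterInt ν M (fun Y => w y * ((Y.map w).prod * C)) ∂ν i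
        = ∫⁻ y, w y * iterInt ν M (fun Y => (Y.map w).prod * C) ∂ν i :=
          lintegral_congr (fun y => iterInt_const_mul ν M (hw y) _)
      _ ≤ ∫⁻ y, w y * (G ^ M.length * C) ∂ν i :=
          lintegral_mono (fun y => mul_le_mul_right ih _)
      _ = (∫⁻ y, w y ∂ν i) * (G ^ M.length * C) := lintegral_mul_const _ hwm
      _ ≤ G * (G ^ M.length * C) := mul_le_mul_left (hG i) _
      _ = G ^ (M.length + 1) * C := by rw [pow_succ' G, mul_assoc]

lemma lintegral_splitSum {α : Type} {μ : Measure (Pt d)} (M : List α)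
    (F : Pt d → List α → List α → ℝ≥0∞) (hF : ∀ S T, Measurable (fun y => F y S T)) :
    Measurable (fun y => splitSum M (F y)) ∧
      ∫⁻ y, splitSum M (F y) ∂μ = splitSum M (fun S T => ∫⁻ y, F y S T ∂μ) := by
  induction M generalizing F with
  | nil => simpa only [splitSum_nil, and_true] using hF [] []
  | cons i M ih =>
    simp only [splitSum_cons]
    obtain ⟨h1, h2⟩ := ih (fun y S T => F y (i :: S) T) (fun S T => hF _ _)
    obtain ⟨h3, h4⟩ := ih (fun y S T => F y S (i :: T)) (fun S T => hF _ _)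
    exact ⟨h1.add h3, by rw [lintegral_add_left h1, h2, h4]⟩

lemma iterInt_replicate_volume {f : List (Pt d) → ℝ≥0∞} (hf : ListMeas f) {i : ι}
    (hi : ν i = volume) (n : ℕ) :
    iterInt ν (List.replicate n i) f = ∫⁻ y : Fin n → Pt d, f (List.ofFn y) := by
  induction n generalizing f with
  | zero => simp [iterInt, lintegral_unique, volume_pi]
  | succ n ih =>
    have hmp := (volume_preserving_piFinSuccAbove (fun _ : Fin (n + 1) => Pt d) 0).symm
    rw [← hmp.lintegral_comp (hf (n + 1))]
    rw [Measure.volume_eq_prod, lintegral_prod _ (by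
      exact ((hf (n + 1)).comp hmp.measurable).aemeasurable)]
    simp only [List.replicate_succ, iterInt, hi]
    refine lintegral_congr (fun y => ?_)
    rw [ih (hf.cons.listMeas y)]
    refine lintegral_congr (fun v => ?_)
    simp [List.ofFn_succ, MeasurableEquiv.piFinSuccAbove, Fin.insertNthEquiv]

variable [∀ i, SFinite (ν i)]

lemma measurable_iterInt {Ω : Type} [MeasurableSpace Ω] {F : Ω → List (Pt d) → ℝ≥0∞}
    (hF : ParamMeas F) (M : List ι) : Measurable (fun w => iterInt ν M (F w)) := by
  induction M generalizing Ω with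
  | nil =>
    have h := (hF 0).comp (f := fun w => (w, (Fin.elim0 : Fin 0 → Pt d))) (by fun_prop)
    simpa [Function.comp_def, iterInt] using h
  | cons i M ih =>
    exact (ih hF.cons).lintegral_prod_right'

lemma iterInt_swap {F : Pt d → List (Pt d) → ℝ≥0∞} (hF : ParamMeas F) (M : List ι)
    (μ : Measure (Pt d)) [SFinite μ] :
    ∫⁻ y, iterInt ν M (F y) ∂μ = iterInt ν M (fun Y => ∫⁻ y, F y Y ∂μ) := by
  induction M generalizing F with
  | nil => rfl
  | cons i M ih =>
    simp only [iterInt]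
    have hm := (measurable_iterInt ν hF.cons M).aemeasurable (μ := μ.prod (ν i))
    rw [lintegral_lintegral_swap hm]
    exact lintegral_congr (fun y' =>
      ih (hF.cons.comp (φ := fun y => (y, y')) (by fun_prop)))

lemma iterInt_add {f g : List (Pt d) → ℝ≥0∞} (hf : ListMeas f) (M : List ι) :
    iterInt ν M (fun Y => f Y + g Y) = iterInt ν M f + iterInt ν M g := by
  induction M generalizing f g with
  | nil => rfl
  | cons i M ih =>
    simp only [iterInt]
    rw [← lintegral_add_left (measurable_iterInt ν hf.cons M)]
    exact lintegral_congr (fun y => ih (hf.cons.listMeas y))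

/-- Tonelli's theorem for sums over splittings: the integral of `∑_{S ⊆ Y} F(S, Y \ S)` splits
according to the measures that the points of `S` and of `Y \ S` are integrated over. -/
lemma iterInt_splitSum {F : List (Pt d) → List (Pt d) → ℝ≥0∞} (hF : PairMeas F) (M : List ι) :
    iterInt ν M (fun Y => splitSum Y F) =
      splitSum M (fun MS MT => iterInt ν MS (fun S => iterInt ν MT (F S))) := by
  induction M generalizing F with
  | nil => simp [iterInt, splitSum_nil]
  | cons i M ih =>
    have hL : ∀ MT : List ι, ParamMeas (fun (y : Pt d) S => iterInt ν MT (F (y :: S))) :=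
      fun MT m => measurable_iterInt ν (hF.consLeft m) MT
    have hR : ∀ MT : List ι,
        ParamMeas (fun (y : Pt d) S => iterInt ν MT (fun T => F S (y :: T))) :=
      fun MT m => measurable_iterInt ν (hF.consRight m) MT
    have hPL : ∀ y : Pt d, PairMeas (fun S T => F (y :: S) T) := fun y m =>
      (hF.consLeft m).comp (φ := fun u => (y, u)) (by fun_prop)
    have hPR : ∀ y : Pt d, PairMeas (fun S T => F S (y :: T)) := fun y m =>
      (hF.consRight m).comp (φ := fun u => (y, u)) (by fun_prop)
    have h1 : ∀ y : Pt d, iterInt ν M (fun Y => splitSum (y :: Y) F) =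
        splitSum M (fun MS MT => iterInt ν MS (fun S => iterInt ν MT (F (y :: S)))) +
        splitSum M (fun MS MT => iterInt ν MS (fun S => iterInt ν MT (fun T => F S (y :: T)))) := by
      intro y
      have hY : (fun Y => splitSum (y :: Y) F) = fun Y =>
          splitSum Y (fun S T => F (y :: S) T + F S (y :: T)) := by
        funext Y
        rw [splitSum_cons, splitSum_add]
      have hPS : PairMeas (fun S T => F (y :: S) T + F S (y :: T)) := fun m n =>
        (hPL y m n).add (hPR y m n)
      rw [hY, ih hPS, ← splitSum_add]
      congr 1
      funext MS MT
      rw [← iterInt_add ν ((hL MT).listMeas y)]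
      congr 1
      funext S
      exact iterInt_add ν ((hPL y).right S) MT
    have h2 := lintegral_splitSum (μ := ν i) M
      (fun y MS MT => iterInt ν MS (fun S => iterInt ν MT (F (y :: S))))
      (fun MS MT => measurable_iterInt ν (hL MT) MS)
    have h3 := lintegral_splitSum (μ := ν i) M
      (fun y MS MT => iterInt ν MS (fun S => iterInt ν MT (fun T => F S (y :: T))))
      (fun MS MT => measurable_iterInt ν (hR MT) MS)
    rw [splitSum_cons]
    simp only [iterInt, h1]
    rw [lintegral_add_left h2.1, h2.2, h3.2]
    congr 2
    funext MS MT
    exact iterInt_swap ν (hR MT) MS (ν i)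

end IterInt

/-! ### Bounds on the integrals of the Ursell functions -/

section Bound

lemma measurable_append {m n : ℕ} {d : ℕ} {Ω : Type} [MeasurableSpace Ω]
    {u : Ω → Fin m → Pt d} {v : Ω → Fin n → Pt d} (hu : Measurable u) (hv : Measurable v) :
    Measurable (fun w => Fin.append (u w) (v w)) := by
  refine measurable_pi_lambda _ (fun i => ?_)
  refine Fin.addCases (fun j => ?_) (fun j => ?_) i
  · simpa [Function.comp_def] using (measurable_pi_apply j).comp hu
  · simpa [Function.comp_def] using (measurable_pi_apply j).comp hv

lemma measurable_seqInv {d : ℕ} {g : Pt d → ℝ} (hg : Measurable g) (m : ℕ) :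
    Measurable (fun v : Fin m → Pt d => seqInv (boltzmann g) (List.ofFn v)) := by
  have h0 : SeqMeas (fun (_ : Unit) => boltzmann g - (seqOne : List (Pt d) → ℝ)) := fun m =>
    ((measurable_boltzmann hg m).sub (measurable_seqOne m)).comp measurable_snd
  have hpow : ∀ k, SeqMeas (fun (_ : Unit) => seqPow (boltzmann g - seqOne) k) := by
    intro k
    induction k with
    | zero => exact fun m => (measurable_seqOne m).comp measurable_snd
    | succ k ih => exact fun m => measurable_seqMul m h0 ih
  simp only [seqInv, List.length_ofFn]
  refine Finset.measurable_sum _ (fun k _ => Measurable.const_mul ?_ _)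
  exact (hpow k m).comp (measurable_const (a := ()) |>.prodMk measurable_id)

lemma measurable_partialUrsell {d : ℕ} {g : Pt d → ℝ} (hg : Measurable g) (X : List (Pt d))
    (m n : ℕ) :
    Measurable (fun p : (Fin m → Pt d) × (Fin n → Pt d) =>
      partialUrsell g (X ++ List.ofFn p.1) (List.ofFn p.2)) := by
  refine measurable_seqMul n (Ω := Fin m → Pt d) (F := fun _ => seqInv (boltzmann g))
    (G := fun u T => boltzmann g (X ++ List.ofFn u ++ T)) ?_ ?_
  · exact fun k => (measurable_seqInv hg k).comp measurable_snd
  · intro k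
    have h1 : Measurable (fun p : (Fin m → Pt d) × (Fin k → Pt d) =>
        Fin.append (Fin.append X.get p.1) p.2) :=
      measurable_append (measurable_append measurable_const measurable_fst) measurable_snd
    have h2 := (measurable_boltzmann hg (X.length + m + k)).comp h1
    simpa only [Function.comp_def, List.ofFn_fin_append, List.ofFn_get] using h2

lemma splitSum_ofReal {α : Type} (M : List α) (F : List α → List α → ℝ)
    (hF : ∀ S T, 0 ≤ F S T) :
    0 ≤ splitSum M F ∧
      ENNReal.ofReal (splitSum M F) = splitSum M (fun S T => ENNReal.ofReal (F S T)) := by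
  induction M generalizing F with
  | nil => simpa only [splitSum_nil, and_true] using hF [] []
  | cons i M ih =>
    simp only [splitSum_cons]
    obtain ⟨h1, h2⟩ := ih (fun S T => F (i :: S) T) (fun S T => hF _ _)
    obtain ⟨h3, h4⟩ := ih (fun S T => F S (i :: T)) (fun S T => hF _ _)
    exact ⟨add_nonneg h1 h3, by rw [ENNReal.ofReal_add h1 h3, h2, h4]⟩

lemma ofReal_list_prod {α : Type} (w : α → ℝ) (hw : ∀ x, 0 ≤ w x) (S : List α) :
    ENNReal.ofReal (S.map w).prod = (S.map (fun s => ENNReal.ofReal (w s))).prod := by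
  induction S with
  | nil => simp
  | cons s S ih => simp [ENNReal.ofReal_mul (hw s), ih]

/-- The growth rate of the Ursell functions per fixed point. -/
noncomputable def rateA : ℝ := Real.exp 4

/-- The growth rate of the Ursell functions per integrated point. -/
noncomputable def rateB (d : ℕ) : ℝ := (weightBound d).toReal * rateA

lemma rateA_pos : 0 < rateA := Real.exp_pos 4

lemma one_le_weightBound (d : ℕ) : 1 ≤ (weightBound d).toReal := by
  have h : (1 : ℝ≥0∞) ≤ weightBound d := by
    have h3 : (1 : ℝ≥0∞) ≤ 5 ^ d + 3 := le_add_left (by norm_num)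
    exact h3.trans (le_mul_of_one_le_right (by simp) (le_max_left _ _))
  simpa using ENNReal.toReal_mono (weightBound_lt_top d).ne h

lemma rateB_pos (d : ℕ) : 0 < rateB d :=
  mul_pos (by linarith [one_le_weightBound d]) rateA_pos

/-- The recursive inequality for the bounds: with `b = G a` and `a = e^4`, the sum over the
sizes of the subsets is at most the exponential series of `1`. -/
lemma splitSum_rate_le {α : Type} (d : ℕ) (n : ℕ) (M : List α) :
    Real.exp 3 * splitSum M (fun S T => (weightBound d).toReal ^ S.length *
      (rateA ^ (n + S.length) * rateB d ^ T.length * T.length.factorial)) ≤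
      rateA ^ (n + 1) * rateB d ^ M.length * M.length.factorial := by
  rw [splitSum_length M (fun i j => (weightBound d).toReal ^ i *
      (rateA ^ (n + i) * rateB d ^ j * j.factorial)),
    Finset.Nat.sum_antidiagonal_eq_sum_range_succ_mk]
  have hterm : ∀ k ∈ Finset.range M.length.succ,
      (M.length.choose k : ℝ) * ((weightBound d).toReal ^ k *
        (rateA ^ (n + k) * rateB d ^ (M.length - k) * (M.length - k).factorial)) =
      rateA ^ n * rateB d ^ M.length * M.length.factorial * (1 ^ k / k.factorial) := by
    intro k hk
    have hk' : k ≤ M.length := Nat.lt_succ_iff.1 (Finset.mem_range.1 hk)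
    have h1 : (M.length.choose k : ℝ) * k.factorial * (M.length - k).factorial =
        M.length.factorial := by exact_mod_cast Nat.choose_mul_factorial_mul_factorial hk'
    have h2 : (weightBound d).toReal ^ k * rateA ^ k = rateB d ^ k := by
      rw [rateB, mul_pow]
    have h3 : rateB d ^ k * rateB d ^ (M.length - k) = rateB d ^ M.length := by
      rw [← pow_add]
      congr 1
      omega
    have hk0 : (k.factorial : ℝ) ≠ 0 := by positivity
    rw [← h1, ← h3, ← h2, pow_add]
    field_simp
    ring
  rw [Finset.sum_congr rfl hterm, ← Finset.mul_sum]
  have hexp : ∑ k ∈ Finset.range M.length.succ, (1 : ℝ) ^ k / k.factorial ≤ Real.exp 1 :=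
    Real.sum_le_exp_of_nonneg zero_le_one _
  have h4 : rateA = Real.exp 3 * Real.exp 1 := by
    rw [rateA, ← Real.exp_add]
    norm_num
  have hpos : 0 ≤ rateA ^ n * rateB d ^ M.length * M.length.factorial := by
    have := rateA_pos
    have := rateB_pos d
    positivity
  calc Real.exp 3 * (rateA ^ n * rateB d ^ M.length * M.length.factorial *
        ∑ k ∈ Finset.range M.length.succ, (1 : ℝ) ^ k / k.factorial)
      ≤ Real.exp 3 * (rateA ^ n * rateB d ^ M.length * M.length.factorial * Real.exp 1) := by
        gcongr
    _ = rateA ^ n * (Real.exp 3 * Real.exp 1) * rateB d ^ M.length * M.length.factorial := by ring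
    _ = rateA ^ (n + 1) * rateB d ^ M.length * M.length.factorial := by rw [← h4, pow_succ]

variable {d : ℕ} {ι : Type} {f₁ f₂ : Pt d → ℝ} {t : ℝ}

lemma ursellSize_nonneg (ht : 0 ≤ t) (X Y : List (Pt d)) : 0 ≤ ursellSize t f₁ f₂ X Y :=
  pairSize_nonneg ht _ _

lemma measurable_ursellSize (h₁ : IsRep f₁) (h₂ : IsRep f₂) (X : List (Pt d)) (m n : ℕ) :
    Measurable (fun p : (Fin m → Pt d) × (Fin n → Pt d) =>
      ursellSize t f₁ f₂ (X ++ List.ofFn p.1) (List.ofFn p.2)) := by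
  have := measurable_partialUrsell h₁.meas X m n
  have := measurable_partialUrsell h₂.meas X m n
  unfold ursellSize pairSize
  fun_prop

/-- The convergence estimate: with respect to measures whose translates integrate the weight to at
most `G`, the integral of the truncated Boltzmann factors over `n` points is at most
`a ^ |X| b ^ n n!`. -/
theorem iterInt_ursellSize_le (h₁ : IsRep f₁) (h₂ : IsRep f₂) (ht : 0 ≤ t)
    (hd : ∀ X : Finset (Pt d), IsC0 X → ∑ x ∈ X, t * |f₁ x - f₂ x| ≤ 1)
    (ν : ι → Measure (Pt d)) [∀ i, SFinite (ν i)]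
    (hν : ∀ i x, ∫⁻ y, ENNReal.ofReal (pairSize t (f₁ (x - y)) (f₂ (x - y))) ∂ν i ≤ weightBound d)
    (X : List (Pt d)) (M : List ι) :
    iterInt ν M (fun Y => ENNReal.ofReal (ursellSize t f₁ f₂ X Y)) ≤
      ENNReal.ofReal (rateA ^ X.length * rateB d ^ M.length * M.length.factorial) := by
  have hW := h₁.isWeight h₂ ht hd
  have ha := rateA_pos
  have hb := rateB_pos d
  obtain ⟨N, hN⟩ : ∃ N, X.length + M.length ≤ N := ⟨_, le_rfl⟩
  induction N generalizing X M with
  | zero =>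
    obtain rfl : X = [] := List.length_eq_zero_iff.1 (by omega)
    obtain rfl : M = [] := List.length_eq_zero_iff.1 (by omega)
    simp [iterInt, ursellSize, partialUrsell_nil, seqOne, pairSize]
  | succ N ih =>
    rcases X with _ | ⟨x, X⟩
    · have h0 : ∀ Y, ursellSize t f₁ f₂ [] Y = seqOne Y := by
        intro Y
        rw [ursellSize, partialUrsell_nil, partialUrsell_nil, pairSize_self]
        cases Y <;> simp [seqOne]
      simp only [h0]
      rcases M with _ | ⟨i, M⟩
      · simp [iterInt, seqOne]
      · have hz : iterInt ν (i :: M) (fun Y => ENNReal.ofReal (seqOne Y)) ≤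
            iterInt ν (i :: M) (fun Y => 0 * ENNReal.ofReal (seqOne Y)) := by
          refine iterInt_mono ν _ (fun Y hY => ?_)
          cases Y with
          | nil => simp at hY
          | cons y Y => simp [seqOne]
        rw [iterInt_const_mul ν _ (by simp), zero_mul] at hz
        exact hz.trans zero_le
    · set w : Pt d → ℝ := fun s => pairSize t (f₁ (x - s)) (f₂ (x - s)) with hw
      have hw0 : ∀ s, 0 ≤ w s := fun s => hW.nonneg (x - s)
      have hwm : Measurable (fun s => ENNReal.ofReal (w s)) :=
        ENNReal.measurable_ofReal.comp (hW.meas.comp (by fun_prop))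
      have hp0 : ∀ S : List (Pt d), 0 ≤ (S.map w).prod := fun S =>
        List.prod_nonneg (by
          intro a ha
          obtain ⟨s, _, rfl⟩ := List.mem_map.1 ha
          exact hw0 s)
      set F : List (Pt d) → List (Pt d) → ℝ≥0∞ := fun S T =>
        ENNReal.ofReal (S.map w).prod * ENNReal.ofReal (ursellSize t f₁ f₂ (X ++ S) T) with hF
      have hFm : PairMeas F := by
        intro m n
        have hm : Measurable (fun p : (Fin m → Pt d) × (Fin n → Pt d) =>
            ENNReal.ofReal ((List.ofFn p.1).map w).prod) := by
          simp only [ofReal_list_prod w hw0]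
          simp only [List.map_ofFn, List.prod_ofFn]
          refine Finset.measurable_prod _ (fun i _ => ?_)
          exact hwm.comp ((measurable_pi_apply i).comp measurable_fst)
        exact hm.mul (ENNReal.measurable_ofReal.comp (measurable_ursellSize h₁ h₂ X m n))
      have hpt : ∀ Y, ENNReal.ofReal (ursellSize t f₁ f₂ (x :: X) Y) ≤
          ENNReal.ofReal (Real.exp 3) * splitSum Y F := by
        intro Y
        refine (ENNReal.ofReal_le_ofReal (ursellSize_cons_le h₁ h₂ ht hd x X Y)).trans ?_
        rw [ENNReal.ofReal_mul (Real.exp_nonneg 3), (splitSum_ofReal Y _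
          (fun S T => mul_nonneg (hp0 S) (ursellSize_nonneg ht _ _))).2]
        simp only [ENNReal.ofReal_mul (hp0 _), hF]
        exact le_rfl
      have hterm : ∀ MS MT : List ι, MS.length + MT.length = M.length →
          iterInt ν MS (fun S => iterInt ν MT (F S)) ≤
          ENNReal.ofReal ((weightBound d).toReal ^ MS.length *
            (rateA ^ (X.length + MS.length) * rateB d ^ MT.length * MT.length.factorial)) := by
        intro MS MT hM
        rw [ENNReal.ofReal_mul (by positivity), ENNReal.ofReal_pow (by positivity),
          ENNReal.ofReal_toReal (weightBound_lt_top d).ne]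
        refine le_trans (iterInt_mono ν MS (fun S hS => ?_)) (iterInt_prod_mul_le ν MS
          (w := fun s => ENNReal.ofReal (w s)) (fun _ => ENNReal.ofReal_ne_top) hwm
          (fun i => hν i x) _)
        rw [iterInt_const_mul ν MT ENNReal.ofReal_ne_top, ofReal_list_prod w hw0]
        refine mul_le_mul_right ?_ _
        have h := ih (X ++ S) MT (by
          rw [List.length_append, hS]
          simp only [List.length_cons] at hN
          omega)
        rwa [List.length_append, hS] at h
      calc iterInt ν M (fun Y => ENNReal.ofReal (ursellSize t f₁ f₂ (x :: X) Y))
          ≤ iterInt ν M (fun Y => ENNReal.ofReal (Real.exp 3) * splitSum Y F) :=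
            iterInt_mono ν M (fun Y _ => hpt Y)
        _ = ENNReal.ofReal (Real.exp 3) *
            splitSum M (fun MS MT => iterInt ν MS (fun S => iterInt ν MT (F S))) := by
            rw [iterInt_const_mul ν M ENNReal.ofReal_ne_top, iterInt_splitSum ν hFm]
        _ ≤ ENNReal.ofReal (Real.exp 3) * splitSum M (fun MS MT =>
            ENNReal.ofReal ((weightBound d).toReal ^ MS.length *
              (rateA ^ (X.length + MS.length) * rateB d ^ MT.length * MT.length.factorial))) :=
            mul_le_mul_right (splitSum_mono hterm) _
        _ ≤ _ := by
            rw [← (splitSum_ofReal M _ (fun S T => by positivity)).2,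
              ← ENNReal.ofReal_mul (Real.exp_nonneg 3)]
            exact ENNReal.ofReal_le_ofReal (splitSum_rate_le d X.length M)

/-- The measures over which the points are integrated: Lebesgue measure, and the counting measure
of a finite set. -/
noncomputable def pointMeasure (Z : Finset (Pt d)) : Bool → Measure (Pt d)
  | true => volume
  | false => ∑ z ∈ Z, Measure.dirac z

instance (Z : Finset (Pt d)) (i : Bool) : SFinite (pointMeasure Z i) := by
  cases i <;> unfold pointMeasure <;> infer_instance

lemma lintegral_sum_dirac (Z : Finset (Pt d)) (f : Pt d → ℝ≥0∞) :
    ∫⁻ y, f y ∂(∑ z ∈ Z, Measure.dirac z) = ∑ z ∈ Z, f z := by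
  rw [lintegral_finsetSum_measure]
  exact Finset.sum_congr rfl (fun z _ => lintegral_dirac z f)

lemma IsWeight.lintegral_pointMeasure_le {γ : Pt d → ℝ} (hγ : IsWeight γ) {Z : Finset (Pt d)}
    (hZ : IsC0 Z) (i : Bool) (x : Pt d) :
    ∫⁻ y, ENNReal.ofReal (γ (x - y)) ∂pointMeasure Z i ≤ weightBound d := by
  cases i with
  | true => exact hγ.lintegral_sub_le x
  | false =>
    rw [pointMeasure, lintegral_sum_dirac]
    exact hγ.sum_sub_le_weightBound x Z hZ.2

lemma listMeas_ursellSize (h₁ : IsRep f₁) (h₂ : IsRep f₂) (X : List (Pt d)) :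
    ListMeas (fun Y => ENNReal.ofReal (ursellSize t f₁ f₂ X Y)) := by
  have h : PairMeas (fun S T => ENNReal.ofReal (ursellSize t f₁ f₂ (X ++ S) T)) :=
    fun m n => ENNReal.measurable_ofReal.comp (measurable_ursellSize h₁ h₂ X m n)
  simpa using h.right []

lemma lintegral_ursellSize_le (h₁ : IsRep f₁) (h₂ : IsRep f₂) (ht : 0 ≤ t)
    (hd : ∀ X : Finset (Pt d), IsC0 X → ∑ x ∈ X, t * |f₁ x - f₂ x| ≤ 1) (n : ℕ) :
    ∫⁻ y : Fin n → Pt d, ENNReal.ofReal (ursellSize t f₁ f₂ [0] (List.ofFn y)) ≤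
      ENNReal.ofReal (rateA * rateB d ^ n * n.factorial) := by
  have hC : IsC0 (∅ : Finset (Pt d)) := by simp [IsC0]
  have h := iterInt_ursellSize_le h₁ h₂ ht hd (pointMeasure ∅)
    (fun i x => (h₁.isWeight h₂ ht hd).lintegral_pointMeasure_le hC i x) [0]
    (List.replicate n true)
  rw [iterInt_replicate_volume _ (listMeas_ursellSize h₁ h₂ [0]) (i := true) rfl] at h
  simpa using h

/-- The integrals of the Ursell functions with a second point fixed, summed over the positions of
that point in a configuration of the class `𝒞₀`. -/
lemma sum_lintegral_ursellSize_le (h₁ : IsRep f₁) (h₂ : IsRep f₂) (ht : 0 ≤ t)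
    (hd : ∀ X : Finset (Pt d), IsC0 X → ∑ x ∈ X, t * |f₁ x - f₂ x| ≤ 1)
    {Z : Finset (Pt d)} (hZ : IsC0 Z) (n : ℕ) :
    ∑ z ∈ Z, ∫⁻ y : Fin n → Pt d, ENNReal.ofReal (ursellSize t f₁ f₂ [0] (z :: List.ofFn y)) ≤
      ENNReal.ofReal (rateA * rateB d ^ (n + 1) * (n + 1).factorial) := by
  have h := iterInt_ursellSize_le h₁ h₂ ht hd (pointMeasure Z)
    (fun i x => (h₁.isWeight h₂ ht hd).lintegral_pointMeasure_le hZ i x) [0]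
    (false :: List.replicate n true)
  have hm := (listMeas_ursellSize (t := t) h₁ h₂ [0]).cons
  simp only [iterInt, pointMeasure, lintegral_sum_dirac] at h
  have he : ∀ z : Pt d, iterInt (pointMeasure Z) (List.replicate n true)
      (fun Y => ENNReal.ofReal (ursellSize t f₁ f₂ [0] (z :: Y))) =
      ∫⁻ y : Fin n → Pt d, ENNReal.ofReal (ursellSize t f₁ f₂ [0] (z :: List.ofFn y)) :=
    fun z => iterInt_replicate_volume _ (hm.listMeas z) (i := true) rfl n
  simp only [he] at h
  simpa using h

end Bound

/-! ### Convergence and Lipschitz estimates for the series -/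

section PowerSeries

lemma summable_majorant : Summable (fun k : ℕ => ((k : ℝ) + 2) ^ 2 * (1 / 2 : ℝ) ^ k) := by
  have h0 := summable_pow_mul_geometric_of_norm_lt_one (R := ℝ) 0 (r := 1 / 2) (by norm_num)
  have h1 := summable_pow_mul_geometric_of_norm_lt_one (R := ℝ) 1 (r := 1 / 2) (by norm_num)
  have h2 := summable_pow_mul_geometric_of_norm_lt_one (R := ℝ) 2 (r := 1 / 2) (by norm_num)
  refine ((h2.add (h1.mul_left 4)).add (h0.mul_left 4)).congr (fun k => ?_)
  ring

/-- Finite families of power series with coefficients of at most geometric growth, summed over the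
family: the sum depends Lipschitz continuously on the argument and on the coefficients. -/
lemma exists_powerSeries_bound {C b : ℝ} (hC : 0 ≤ C) (hb : 0 < b) :
    ∃ K : ℝ, 0 ≤ K ∧ ∀ (α : Type) (Z : Finset α) (β₁ β₂ : α → ℕ → ℝ) (ε : ℝ), 0 ≤ ε →
      (∀ k, ∑ x ∈ Z, |β₁ x k| ≤ C * ((k + 2) * b ^ k)) →
      (∀ k, ∑ x ∈ Z, |β₂ x k| ≤ C * ((k + 2) * b ^ k)) →
      (∀ k, ∑ x ∈ Z, |β₁ x k - β₂ x k| ≤ ε * (C * ((k + 2) * b ^ k))) →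
      ∀ z₁ z₂ : ℝ, |z₁| ≤ 1 / (2 * b) → |z₂| ≤ 1 / (2 * b) →
        ∑ x ∈ Z, |∑' k, z₁ ^ k * β₁ x k - ∑' k, z₂ ^ k * β₂ x k| ≤ K * (|z₁ - z₂| + ε) := by
  set s : ℕ → ℝ := fun k => C * (1 + 2 * b) * (((k : ℝ) + 2) ^ 2 * (1 / 2 : ℝ) ^ k) with hs
  have hsum : Summable s := summable_majorant.mul_left _
  have hs0 : ∀ k, 0 ≤ s k := fun k => by positivity
  refine ⟨∑' k, s k, tsum_nonneg hs0, fun α Z β₁ β₂ ε hε h₁ h₂ h₁₂ z₁ z₂ hz₁ hz₂ => ?_⟩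
  have hpow : ∀ z : ℝ, |z| ≤ 1 / (2 * b) → ∀ k : ℕ, |z| ^ k * b ^ k ≤ (1 / 2) ^ k := by
    intro z hz k
    rw [← mul_pow]
    refine pow_le_pow_left₀ (by positivity) ?_ k
    calc |z| * b ≤ 1 / (2 * b) * b := by gcongr
      _ = 1 / 2 := by field_simp
  have hsummable : ∀ (β : α → ℕ → ℝ), (∀ k, ∑ x ∈ Z, |β x k| ≤ C * ((k + 2) * b ^ k)) →
      ∀ z : ℝ, |z| ≤ 1 / (2 * b) → ∀ x ∈ Z, Summable (fun k => z ^ k * β x k) := by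
    intro β hβ z hz x hx
    refine Summable.of_norm_bounded hsum (fun k => ?_)
    have h1 : |β x k| ≤ C * ((k + 2) * b ^ k) :=
      (Finset.single_le_sum (f := fun x => |β x k|) (fun _ _ => abs_nonneg _) hx).trans (hβ k)
    rw [Real.norm_eq_abs, abs_mul, abs_pow]
    calc |z| ^ k * |β x k| ≤ |z| ^ k * (C * ((k + 2) * b ^ k)) := by gcongr
      _ = C * 1 * ((k + 2) * 1 * (|z| ^ k * b ^ k)) := by ring
      _ ≤ C * (1 + 2 * b) * ((k + 2) * (k + 2) * (1 / 2) ^ k) := by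
          gcongr
          · linarith
          · have : (0 : ℝ) ≤ k := k.cast_nonneg
            linarith
          · exact hpow z hz k
      _ = s k := by
          rw [hs]
          ring
  have hdiff : ∀ k, ∑ x ∈ Z, |z₁ ^ k * β₁ x k - z₂ ^ k * β₂ x k| ≤
      s k * (|z₁ - z₂| + ε) := by
    intro k
    have hzk : |z₁ ^ k - z₂ ^ k| * b ^ k ≤ 2 * b * (k * (1 / 2) ^ k) * |z₁ - z₂| := by
      rcases k with _ | k
      · simp
      · have h3 := abs_pow_sub_pow_le z₁ z₂ (k + 1)
        have h4 : max |z₁| |z₂| ^ k ≤ (1 / (2 * b)) ^ k :=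
          pow_le_pow_left₀ (le_max_of_le_left (abs_nonneg _)) (max_le hz₁ hz₂) k
        calc |z₁ ^ (k + 1) - z₂ ^ (k + 1)| * b ^ (k + 1)
            ≤ |z₁ - z₂| * (k + 1 : ℕ) * (1 / (2 * b)) ^ k * b ^ (k + 1) := by
              refine mul_le_mul_of_nonneg_right (h3.trans ?_) (by positivity)
              exact mul_le_mul_of_nonneg_left h4 (by positivity)
          _ = 2 * b * ((k + 1 : ℕ) * (1 / 2) ^ (k + 1)) * |z₁ - z₂| := by
              rw [one_div, inv_pow, mul_pow, one_div, inv_pow]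
              field_simp
              ring
    have hterm : ∀ x, |z₁ ^ k * β₁ x k - z₂ ^ k * β₂ x k| ≤
        |z₁| ^ k * |β₁ x k - β₂ x k| + |z₁ ^ k - z₂ ^ k| * |β₂ x k| := by
      intro x
      have : z₁ ^ k * β₁ x k - z₂ ^ k * β₂ x k =
          z₁ ^ k * (β₁ x k - β₂ x k) + (z₁ ^ k - z₂ ^ k) * β₂ x k := by ring
      rw [this]
      refine (abs_add_le _ _).trans (le_of_eq ?_)
      rw [abs_mul, abs_mul, abs_pow]
    calc ∑ x ∈ Z, |z₁ ^ k * β₁ x k - z₂ ^ k * β₂ x k|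
        ≤ ∑ x ∈ Z, (|z₁| ^ k * |β₁ x k - β₂ x k| + |z₁ ^ k - z₂ ^ k| * |β₂ x k|) :=
          Finset.sum_le_sum (fun x _ => hterm x)
      _ = |z₁| ^ k * ∑ x ∈ Z, |β₁ x k - β₂ x k| + |z₁ ^ k - z₂ ^ k| * ∑ x ∈ Z, |β₂ x k| := by
          rw [Finset.sum_add_distrib, Finset.mul_sum, Finset.mul_sum]
      _ ≤ |z₁| ^ k * (ε * (C * ((k + 2) * b ^ k))) +
          |z₁ ^ k - z₂ ^ k| * (C * ((k + 2) * b ^ k)) := by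
          gcongr
          · exact h₁₂ k
          · exact h₂ k
      _ = C * (k + 2) * (ε * (|z₁| ^ k * b ^ k) + |z₁ ^ k - z₂ ^ k| * b ^ k) := by ring
      _ ≤ C * (k + 2) * (ε * (1 / 2) ^ k + 2 * b * (k * (1 / 2) ^ k) * |z₁ - z₂|) := by
          gcongr
          exact hpow z₁ hz₁ k
      _ = C * (k + 2) * (1 / 2) ^ k * (1 * ε + 2 * b * k * |z₁ - z₂|) := by ring
      _ ≤ C * (k + 2) * (1 / 2) ^ k *
          ((1 + 2 * b) * (k + 2) * ε + (1 + 2 * b) * (k + 2) * |z₁ - z₂|) := by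
          have hk : (0 : ℝ) ≤ k := k.cast_nonneg
          gcongr
          · nlinarith
          · linarith
          · linarith
      _ = s k * (|z₁ - z₂| + ε) := by
          rw [hs]
          ring
  have hsumd : ∀ x ∈ Z, Summable (fun k => |z₁ ^ k * β₁ x k - z₂ ^ k * β₂ x k|) :=
    fun x hx => ((hsummable β₁ h₁ z₁ hz₁ x hx).sub (hsummable β₂ h₂ z₂ hz₂ x hx)).abs
  calc ∑ x ∈ Z, |∑' k, z₁ ^ k * β₁ x k - ∑' k, z₂ ^ k * β₂ x k|
      ≤ ∑ x ∈ Z, ∑' k, |z₁ ^ k * β₁ x k - z₂ ^ k * β₂ x k| := by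
        refine Finset.sum_le_sum (fun x hx => ?_)
        rw [← (hsummable β₁ h₁ z₁ hz₁ x hx).tsum_sub (hsummable β₂ h₂ z₂ hz₂ x hx)]
        have h := norm_tsum_le_tsum_norm (f := fun k => z₁ ^ k * β₁ x k - z₂ ^ k * β₂ x k)
          (hsumd x hx)
        simpa only [Real.norm_eq_abs] using h
    _ = ∑' k, ∑ x ∈ Z, |z₁ ^ k * β₁ x k - z₂ ^ k * β₂ x k| :=
        (Summable.tsum_finsetSum hsumd).symm
    _ ≤ ∑' k, s k * (|z₁ - z₂| + ε) :=
        Summable.tsum_le_tsum hdiff (summable_sum hsumd) (hsum.mul_right _)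
    _ = (∑' k, s k) * (|z₁ - z₂| + ε) := tsum_mul_right

end PowerSeries

section Coefficients

variable {d : ℕ} {f f₁ f₂ : Pt d → ℝ} {t : ℝ}

lemma IsRep.sum_diff_self (f : Pt d → ℝ) (X : Finset (Pt d)) (_ : IsC0 X) :
    ∑ x ∈ X, (0 : ℝ) * |f x - f x| ≤ 1 := by
  simp

lemma measurable_ursell_cons {f : Pt d → ℝ} (hf : Measurable f) (x : Pt d) (n : ℕ) :
    Measurable (fun y : Fin n → Pt d => ursell f (x :: List.ofFn y)) := by
  have h := (measurable_ursell hf (n + 1)).comp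
    (measurable_cons (Ω := Fin n → Pt d) (a := fun _ => x) measurable_const measurable_id)
  simpa [Function.comp_def, List.ofFn_succ] using h

lemma measurable_ursell_cons_cons {f : Pt d → ℝ} (hf : Measurable f) (x x' : Pt d) (n : ℕ) :
    Measurable (fun y : Fin n → Pt d => ursell f (x :: x' :: List.ofFn y)) := by
  have h := (measurable_ursell_cons hf x (n + 1)).comp
    (measurable_cons (Ω := Fin n → Pt d) (a := fun _ => x') measurable_const measurable_id)
  simpa [Function.comp_def, List.ofFn_succ] using h

lemma ursellSize_singleton (t : ℝ) (x : Pt d) (Y : List (Pt d)) :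
    ursellSize t f₁ f₂ [x] Y = pairSize t (ursell f₁ (x :: Y)) (ursell f₂ (x :: Y)) := by
  rw [ursellSize, ursell_cons, ursell_cons]

lemma ofReal_integral_abs {n : ℕ} {u : (Fin n → Pt d) → ℝ} (hu : Measurable u) :
    ENNReal.ofReal (∫ y, |u y|) ≤ ∫⁻ y, ENNReal.ofReal |u y| := by
  rw [integral_eq_lintegral_of_nonneg_ae (Filter.Eventually.of_forall (fun _ => abs_nonneg _))
    hu.abs.aestronglyMeasurable]
  exact ENNReal.ofReal_toReal_le

lemma integrable_of_lintegral_abs {n : ℕ} {u : (Fin n → Pt d) → ℝ} (hu : Measurable u)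
    (h : ∫⁻ y, ENNReal.ofReal |u y| < ∞) : Integrable u := by
  refine ⟨hu.aestronglyMeasurable, ?_⟩
  rw [hasFiniteIntegral_iff_norm]
  exact h

lemma IsRep.lintegral_ursell_le (hf : IsRep f) (n : ℕ) :
    ∫⁻ y : Fin n → Pt d, ENNReal.ofReal |ursell f (0 :: List.ofFn y)| ≤
      ENNReal.ofReal (rateA * rateB d ^ n * n.factorial) := by
  have h := lintegral_ursellSize_le hf hf le_rfl (IsRep.sum_diff_self f) n
  simpa only [ursellSize_singleton, pairSize_self] using h

lemma IsRep.sum_lintegral_ursell_le (hf : IsRep f) {Z : Finset (Pt d)} (hZ : IsC0 Z) (n : ℕ) :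
    ∑ z ∈ Z, ∫⁻ y : Fin n → Pt d, ENNReal.ofReal |ursell f (0 :: z :: List.ofFn y)| ≤
      ENNReal.ofReal (rateA * rateB d ^ (n + 1) * (n + 1).factorial) := by
  have h := sum_lintegral_ursellSize_le hf hf le_rfl (IsRep.sum_diff_self f) hZ n
  simpa only [ursellSize_singleton, pairSize_self] using h

lemma IsRep.integrable_ursell (hf : IsRep f) (n : ℕ) :
    Integrable (fun y : Fin n → Pt d => ursell f (0 :: List.ofFn y)) :=
  integrable_of_lintegral_abs (measurable_ursell_cons hf.meas 0 n)
    ((hf.lintegral_ursell_le n).trans_lt ENNReal.ofReal_lt_top)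

lemma IsRep.integrable_ursell_cons (hf : IsRep f) {x : Pt d} (hx : 1 ≤ ‖x‖) (n : ℕ) :
    Integrable (fun y : Fin n → Pt d => ursell f (0 :: x :: List.ofFn y)) := by
  refine integrable_of_lintegral_abs (measurable_ursell_cons_cons hf.meas 0 x n) ?_
  have h := hf.sum_lintegral_ursell_le (isC0_singleton hx) n
  rw [Finset.sum_singleton] at h
  exact h.trans_lt ENNReal.ofReal_lt_top

lemma IsRep.integral_abs_ursell_le (hf : IsRep f) (n : ℕ) :
    ∫ y : Fin n → Pt d, |ursell f (0 :: List.ofFn y)| ≤ rateA * rateB d ^ n * n.factorial := by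
  have ha := rateA_pos
  have hb := rateB_pos d
  rw [← ENNReal.ofReal_le_ofReal_iff (by positivity)]
  exact (ofReal_integral_abs (measurable_ursell_cons hf.meas 0 n)).trans (hf.lintegral_ursell_le n)

lemma IsRep.sum_integral_abs_ursell_le (hf : IsRep f) {Z : Finset (Pt d)} (hZ : IsC0 Z) (n : ℕ) :
    ∑ z ∈ Z, ∫ y : Fin n → Pt d, |ursell f (0 :: z :: List.ofFn y)| ≤
      rateA * rateB d ^ (n + 1) * (n + 1).factorial := by
  have ha := rateA_pos
  have hb := rateB_pos d
  rw [← ENNReal.ofReal_le_ofReal_iff (by positivity),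
    ENNReal.ofReal_sum_of_nonneg (fun z _ => integral_nonneg (fun y => abs_nonneg _))]
  exact (Finset.sum_le_sum (fun z _ =>
    ofReal_integral_abs (measurable_ursell_cons_cons hf.meas 0 z n))).trans
    (hf.sum_lintegral_ursell_le hZ n)

/-- The size of a difference of integrals, scaled by `t`, is at most the integral of the size. -/
lemma ofReal_mul_abs_integral_sub_le {n : ℕ} {u v : (Fin n → Pt d) → ℝ} (hu : Integrable u)
    (hv : Integrable v) (ht : 0 ≤ t) :
    ENNReal.ofReal (t * |(∫ y, u y) - ∫ y, v y|) ≤ ∫⁻ y, ENNReal.ofReal (pairSize t (u y) (v y)) := by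
  rw [← integral_sub hu hv, ENNReal.ofReal_mul ht]
  have h := enorm_integral_le_lintegral_enorm (μ := volume) (fun y => u y - v y)
  simp only [Real.enorm_eq_ofReal_abs] at h
  refine (mul_le_mul_right h _).trans ?_
  rw [← lintegral_const_mul' _ _ ENNReal.ofReal_ne_top]
  refine lintegral_mono (fun y => ?_)
  rw [← ENNReal.ofReal_mul ht]
  exact ENNReal.ofReal_le_ofReal (mul_abs_sub_le_pairSize _ _)

lemma IsRep.mul_abs_sub_le (h₁ : IsRep f₁) (h₂ : IsRep f₂) (ht : 0 ≤ t)
    (hd : ∀ X : Finset (Pt d), IsC0 X → ∑ x ∈ X, t * |f₁ x - f₂ x| ≤ 1) (n : ℕ) :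
    t * |(∫ y : Fin n → Pt d, ursell f₁ (0 :: List.ofFn y)) -
      ∫ y : Fin n → Pt d, ursell f₂ (0 :: List.ofFn y)| ≤ rateA * rateB d ^ n * n.factorial := by
  have ha := rateA_pos
  have hb := rateB_pos d
  rw [← ENNReal.ofReal_le_ofReal_iff (by positivity)]
  refine (ofReal_mul_abs_integral_sub_le (h₁.integrable_ursell n) (h₂.integrable_ursell n)
    ht).trans ?_
  simpa only [ursellSize_singleton] using lintegral_ursellSize_le h₁ h₂ ht hd n

lemma IsRep.sum_mul_abs_sub_le (h₁ : IsRep f₁) (h₂ : IsRep f₂) (ht : 0 ≤ t)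
    (hd : ∀ X : Finset (Pt d), IsC0 X → ∑ x ∈ X, t * |f₁ x - f₂ x| ≤ 1)
    {Z : Finset (Pt d)} (hZ : IsC0 Z) (n : ℕ) :
    ∑ z ∈ Z, t * |(∫ y : Fin n → Pt d, ursell f₁ (0 :: z :: List.ofFn y)) -
      ∫ y : Fin n → Pt d, ursell f₂ (0 :: z :: List.ofFn y)| ≤
      rateA * rateB d ^ (n + 1) * (n + 1).factorial := by
  have ha := rateA_pos
  have hb := rateB_pos d
  rw [← ENNReal.ofReal_le_ofReal_iff (by positivity),
    ENNReal.ofReal_sum_of_nonneg (fun z _ => by positivity)]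
  refine (Finset.sum_le_sum (fun z hz => ofReal_mul_abs_integral_sub_le
    (h₁.integrable_ursell_cons (hZ.1 z hz) n) (h₂.integrable_ursell_cons (hZ.1 z hz) n)
    ht)).trans ?_
  simpa only [ursellSize_singleton] using sum_lintegral_ursellSize_le h₁ h₂ ht hd hZ n

/-- The coefficients of the power series `A(·, f)`. -/
noncomputable def coeffA (f : Pt d → ℝ) (k : ℕ) : ℝ :=
  (∫ y : Fin (k + 1) → Pt d, ursell f (0 :: List.ofFn y)) / ((k + 1).factorial : ℝ)

/-- The coefficients of the power series `B(·, f)(x)`. -/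
noncomputable def coeffB (f : Pt d → ℝ) (x : Pt d) (k : ℕ) : ℝ :=
  (∫ y : Fin (k + 1) → Pt d, ursell f (0 :: x :: List.ofFn y)) / ((k + 1).factorial : ℝ)

lemma seriesA_eq (z : ℝ) (f : Pt d → ℝ) : seriesA z f = ∑' k, z ^ k * coeffA f k := by
  unfold seriesA coeffA
  exact tsum_congr (fun k => by ring)

lemma seriesB_eq (z : ℝ) (f : Pt d → ℝ) (x : Pt d) :
    seriesB z f x = ∑' k, z ^ k * coeffB f x k := by
  unfold seriesB coeffB
  exact tsum_congr (fun k => by ring)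

/-- A common constant in the bounds of the coefficients of both series. -/
noncomputable def coeffConst (d : ℕ) : ℝ := rateA * rateB d * (1 + rateB d)

lemma coeffConst_pos (d : ℕ) : 0 < coeffConst d := by
  have ha := rateA_pos
  have hb := rateB_pos d
  unfold coeffConst
  positivity

lemma rate_div_le (d k : ℕ) :
    rateA * rateB d ^ (k + 1) * (k + 1).factorial / ((k + 1).factorial : ℝ) ≤
      coeffConst d * ((k + 2) * rateB d ^ k) := by
  have ha := rateA_pos
  have hb := rateB_pos d
  rw [mul_div_assoc, div_self (by positivity), mul_one, coeffConst]
  have hk : (0 : ℝ) ≤ k := k.cast_nonneg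
  calc rateA * rateB d ^ (k + 1) = rateA * rateB d * 1 * (1 * rateB d ^ k) := by ring
    _ ≤ rateA * rateB d * (1 + rateB d) * ((k + 2) * rateB d ^ k) := by
      gcongr <;> linarith

lemma rate_div_le' (d k : ℕ) :
    rateA * rateB d ^ (k + 1 + 1) * (k + 1 + 1).factorial / ((k + 1).factorial : ℝ) ≤
      coeffConst d * ((k + 2) * rateB d ^ k) := by
  have ha := rateA_pos
  have hb := rateB_pos d
  have hk0 : ((k + 1).factorial : ℝ) ≠ 0 := by positivity
  rw [Nat.factorial_succ (k + 1), Nat.cast_mul, div_le_iff₀ (by positivity), coeffConst]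
  have hk : (0 : ℝ) ≤ k := k.cast_nonneg
  push_cast
  calc rateA * rateB d ^ (k + 1 + 1) * ((k + 1 + 1) * (k + 1).factorial)
      = rateA * rateB d * rateB d * ((k + 2) * rateB d ^ k) * (k + 1).factorial := by ring
    _ ≤ rateA * rateB d * (1 + rateB d) * ((k + 2) * rateB d ^ k) * (k + 1).factorial := by
      gcongr
      linarith

lemma IsRep.abs_coeffA_le (hf : IsRep f) (k : ℕ) :
    |coeffA f k| ≤ coeffConst d * ((k + 2) * rateB d ^ k) := by
  refine le_trans ?_ (rate_div_le d k)
  rw [coeffA, abs_div, abs_of_pos (by positivity : (0 : ℝ) < (k + 1).factorial)]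
  gcongr
  exact abs_integral_le_integral_abs.trans (hf.integral_abs_ursell_le (k + 1))

lemma IsRep.sum_abs_coeffB_le (hf : IsRep f) {Z : Finset (Pt d)} (hZ : IsC0 Z) (k : ℕ) :
    ∑ x ∈ Z, |coeffB f x k| ≤ coeffConst d * ((k + 2) * rateB d ^ k) := by
  refine le_trans ?_ (rate_div_le' d k)
  simp only [coeffB, abs_div, abs_of_pos (by positivity : (0 : ℝ) < (k + 1).factorial)]
  rw [← Finset.sum_div]
  gcongr
  exact (Finset.sum_le_sum (fun z _ => abs_integral_le_integral_abs)).trans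
    (hf.sum_integral_abs_ursell_le hZ (k + 1))

lemma IsRep.abs_coeffA_sub_le (h₁ : IsRep f₁) (h₂ : IsRep f₂) {ε : ℝ} (hε : 0 < ε)
    (hd : ∀ X : Finset (Pt d), IsC0 X → ∑ x ∈ X, |f₁ x - f₂ x| ≤ ε) (k : ℕ) :
    |coeffA f₁ k - coeffA f₂ k| ≤ ε * (coeffConst d * ((k + 2) * rateB d ^ k)) := by
  have hd' : ∀ X : Finset (Pt d), IsC0 X → ∑ x ∈ X, ε⁻¹ * |f₁ x - f₂ x| ≤ 1 := by
    intro X hX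
    rw [← Finset.mul_sum, inv_mul_le_iff₀ hε, mul_one]
    exact hd X hX
  have h := h₁.mul_abs_sub_le h₂ (inv_nonneg.2 hε.le) hd' (k + 1)
  rw [inv_mul_le_iff₀ hε] at h
  rw [coeffA, coeffA, ← sub_div, abs_div,
    abs_of_pos (by positivity : (0 : ℝ) < (k + 1).factorial)]
  refine le_trans ?_ (mul_le_mul_of_nonneg_left (rate_div_le d k) hε.le)
  rw [← mul_div_assoc]
  gcongr

lemma IsRep.sum_abs_coeffB_sub_le (h₁ : IsRep f₁) (h₂ : IsRep f₂) {ε : ℝ} (hε : 0 < ε)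
    (hd : ∀ X : Finset (Pt d), IsC0 X → ∑ x ∈ X, |f₁ x - f₂ x| ≤ ε)
    {Z : Finset (Pt d)} (hZ : IsC0 Z) (k : ℕ) :
    ∑ x ∈ Z, |coeffB f₁ x k - coeffB f₂ x k| ≤
      ε * (coeffConst d * ((k + 2) * rateB d ^ k)) := by
  have hd' : ∀ X : Finset (Pt d), IsC0 X → ∑ x ∈ X, ε⁻¹ * |f₁ x - f₂ x| ≤ 1 := by
    intro X hX
    rw [← Finset.mul_sum, inv_mul_le_iff₀ hε, mul_one]
    exact hd X hX
  have h := h₁.sum_mul_abs_sub_le h₂ (inv_nonneg.2 hε.le) hd' hZ (k + 1)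
  rw [← Finset.mul_sum, inv_mul_le_iff₀ hε] at h
  simp only [coeffB, ← sub_div, abs_div,
    abs_of_pos (by positivity : (0 : ℝ) < (k + 1).factorial)]
  refine le_trans ?_ (mul_le_mul_of_nonneg_left (rate_div_le' d k) hε.le)
  rw [← Finset.sum_div, ← mul_div_assoc]
  gcongr

/-- The radius on which the series are controlled. -/
noncomputable def seriesRadius (d : ℕ) : ℝ := 1 / (2 * rateB d)

lemma seriesRadius_pos (d : ℕ) : 0 < seriesRadius d := by
  have := rateB_pos d
  unfold seriesRadius
  positivity

lemma summable_of_coeff_le {z : ℝ} (hz : |z| ≤ seriesRadius d) {β : ℕ → ℝ} (hβ0 : ∀ k, 0 ≤ β k)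
    (hβ : ∀ k, β k ≤ coeffConst d * ((k + 2) * rateB d ^ k)) :
    Summable (fun k => |z| ^ k * β k) := by
  have hb := rateB_pos d
  have hC := coeffConst_pos d
  refine Summable.of_nonneg_of_le (fun k => mul_nonneg (by positivity) (hβ0 k)) (fun k => ?_)
    (summable_majorant.mul_left (coeffConst d))
  have hk : (0 : ℝ) ≤ k := k.cast_nonneg
  have h1 : |z| ^ k * rateB d ^ k ≤ (1 / 2) ^ k := by
    rw [← mul_pow]
    refine pow_le_pow_left₀ (by positivity) ?_ k
    calc |z| * rateB d ≤ 1 / (2 * rateB d) * rateB d := mul_le_mul_of_nonneg_right hz hb.le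
      _ = 1 / 2 := by field_simp
  calc |z| ^ k * β k ≤ |z| ^ k * (coeffConst d * ((k + 2) * rateB d ^ k)) := by
        gcongr
        exact hβ k
    _ = coeffConst d * ((k + 2) * 1 * (|z| ^ k * rateB d ^ k)) := by ring
    _ ≤ coeffConst d * ((k + 2) * (k + 2) * (1 / 2) ^ k) := by
        gcongr
        linarith
    _ = coeffConst d * ((k + 2) ^ 2 * (1 / 2) ^ k) := by ring

lemma IsRep.convergesA (hf : IsRep f) {z : ℝ} (hz : |z| ≤ seriesRadius d) : ConvergesA z f := by
  refine ⟨fun k => hf.integrable_ursell (k + 1), ?_⟩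
  refine (summable_of_coeff_le hz (β := fun k =>
    (∫ y : Fin (k + 1) → Pt d, |ursell f (0 :: List.ofFn y)|) / ((k + 1).factorial : ℝ))
    (fun k => ?_) (fun k => ?_)).congr (fun k => by ring)
  · exact div_nonneg (integral_nonneg (fun y => abs_nonneg _)) (by positivity)
  · refine le_trans ?_ (rate_div_le d k)
    gcongr
    exact hf.integral_abs_ursell_le (k + 1)

lemma IsRep.convergesB (hf : IsRep f) {z : ℝ} (hz : |z| ≤ seriesRadius d) {x : Pt d}
    (hx : 1 ≤ ‖x‖) : ConvergesB z f x := by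
  refine ⟨fun k => hf.integrable_ursell_cons hx (k + 1), ?_⟩
  refine (summable_of_coeff_le hz (β := fun k =>
    (∫ y : Fin (k + 1) → Pt d, |ursell f (0 :: x :: List.ofFn y)|) / ((k + 1).factorial : ℝ))
    (fun k => ?_) (fun k => ?_)).congr (fun k => by ring)
  · exact div_nonneg (integral_nonneg (fun y => abs_nonneg _)) (by positivity)
  · refine le_trans ?_ (rate_div_le' d k)
    have h := hf.sum_integral_abs_ursell_le (isC0_singleton hx) (k + 1)
    rw [Finset.sum_singleton] at h
    gcongr

/-- The number `K` bounds the series `A` and `B` and their Lipschitz constants. -/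
def SeriesBound (d : ℕ) (K : ℝ) : Prop :=
  0 ≤ K ∧ ∀ f₁ f₂ : Pt d → ℝ, IsRep f₁ → IsRep f₂ → ∀ z₁ z₂ : ℝ,
    |z₁| ≤ seriesRadius d → |z₂| ≤ seriesRadius d →
    |seriesA z₁ f₁| ≤ K ∧
    (∀ Z : Finset (Pt d), IsC0 Z → ∑ x ∈ Z, |seriesB z₁ f₁ x| ≤ K) ∧
    ∀ ε : ℝ, 0 < ε → (∀ X : Finset (Pt d), IsC0 X → ∑ x ∈ X, |f₁ x - f₂ x| ≤ ε) →
      |seriesA z₁ f₁ - seriesA z₂ f₂| ≤ K * (|z₁ - z₂| + ε) ∧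
      ∀ Z : Finset (Pt d), IsC0 Z →
        ∑ x ∈ Z, |seriesB z₁ f₁ x - seriesB z₂ f₂ x| ≤ K * (|z₁ - z₂| + ε)

theorem exists_seriesBound (d : ℕ) : ∃ K : ℝ, SeriesBound d K := by
  have hC := coeffConst_pos d
  have hb := rateB_pos d
  obtain ⟨K, hK, h⟩ := exists_powerSeries_bound hC.le hb
  refine ⟨K, hK, fun f₁ f₂ h₁ h₂ z₁ z₂ hz₁ hz₂ => ⟨?_, fun Z hZ => ?_, fun ε hε hd =>
    ⟨?_, fun Z hZ => ?_⟩⟩⟩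
  · have := h Unit {()} (fun _ => coeffA f₁) (fun _ _ => 0) 1 zero_le_one
      (fun k => by simpa using h₁.abs_coeffA_le k) (fun k => by simp; positivity)
      (fun k => by simpa using h₁.abs_coeffA_le k) z₁ z₁ hz₁ hz₁
    simpa [seriesA_eq] using this
  · have := h (Pt d) Z (coeffB f₁) (fun _ _ => 0) 1 zero_le_one
      (fun k => h₁.sum_abs_coeffB_le hZ k) (fun k => by simp; positivity)
      (fun k => by simpa using h₁.sum_abs_coeffB_le hZ k) z₁ z₁ hz₁ hz₁
    simpa [seriesB_eq] using this
  · have := h Unit {()} (fun _ => coeffA f₁) (fun _ => coeffA f₂) ε hε.le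
      (fun k => by simpa using h₁.abs_coeffA_le k) (fun k => by simpa using h₂.abs_coeffA_le k)
      (fun k => by simpa using h₁.abs_coeffA_sub_le h₂ hε hd k) z₁ z₂ hz₁ hz₂
    simpa [seriesA_eq] using this
  · have := h (Pt d) Z (coeffB f₁) (coeffB f₂) ε hε.le
      (fun k => h₁.sum_abs_coeffB_le hZ k) (fun k => h₂.sum_abs_coeffB_le hZ k)
      (fun k => h₁.sum_abs_coeffB_sub_le h₂ hε hd hZ k) z₁ z₂ hz₁ hz₂
    simpa only [seriesB_eq] using this

end Coefficients

/-! ### The norm and everywhere defined representatives -/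

section Norm

variable {d : ℕ}

lemma supSum_mono {f g : Pt d → ℝ} (h : ∀ x, 1 ≤ ‖x‖ → |f x| ≤ |g x|) : supSum f ≤ supSum g :=
  iSup₂_mono (fun _ hX => Finset.sum_le_sum (fun x hx =>
    ENNReal.ofReal_le_ofReal (h x (hX.1 x hx))))

lemma supSum_add_le (f g : Pt d → ℝ) : supSum (fun x => f x + g x) ≤ supSum f + supSum g := by
  refine iSup₂_le (fun X hX => ?_)
  calc ∑ x ∈ X, ENNReal.ofReal |f x + g x|
      ≤ ∑ x ∈ X, (ENNReal.ofReal |f x| + ENNReal.ofReal |g x|) := by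
        refine Finset.sum_le_sum (fun x _ => ?_)
        rw [← ENNReal.ofReal_add (abs_nonneg _) (abs_nonneg _)]
        exact ENNReal.ofReal_le_ofReal (abs_add_le _ _)
    _ ≤ supSum f + supSum g := by
        rw [Finset.sum_add_distrib]
        exact add_le_add
          (le_iSup₂_of_le (f := fun (X : Finset (Pt d)) (_ : IsC0 X) =>
            ∑ x ∈ X, ENNReal.ofReal |f x|) X hX le_rfl)
          (le_iSup₂_of_le (f := fun (X : Finset (Pt d)) (_ : IsC0 X) =>
            ∑ x ∈ X, ENNReal.ofReal |g x|) X hX le_rfl)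

lemma cnorm_le_supSum {f : Pt d → ℝ} {g : Pt d →ₘ[volume] ℝ} (h : f =ᵐ[volume] g) :
    cnorm g ≤ supSum f := iInf₂_le f h

/-- A null set outside of which the class takes the values that matter for its norm: every
function that is dominated by the class off this set and vanishes on it realizes at most the
norm. In particular the minimum over the representatives is attained. -/
lemma exists_null_supSum_le (g : Pt d →ₘ[volume] ℝ) :
    ∃ N : Set (Pt d), volume N = 0 ∧ ∀ f : Pt d → ℝ,
      (∀ x, 1 ≤ ‖x‖ → f x ≠ 0 → x ∉ N ∧ |f x| ≤ |g x|) → supSum f ≤ cnorm g := by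
  by_cases htop : cnorm g = ∞
  · exact ⟨∅, measure_empty, fun f _ => by rw [htop]; exact le_top⟩
  have hex : ∀ n : ℕ, ∃ f' : Pt d → ℝ, f' =ᵐ[volume] g ∧
      supSum f' ≤ cnorm g + ((n : ℝ≥0∞) + 1)⁻¹ := by
    intro n
    have hlt : cnorm g < cnorm g + ((n : ℝ≥0∞) + 1)⁻¹ :=
      ENNReal.lt_add_right htop (by simp)
    obtain ⟨f', hlt1⟩ := iInf_lt_iff.1 hlt
    obtain ⟨hf', hlt'⟩ := iInf_lt_iff.1 hlt1
    exact ⟨f', hf', hlt'.le⟩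
  choose F hF hFle using hex
  refine ⟨⋃ n, {x | ¬ F n x = g x}, measure_iUnion_null (fun n => ae_iff.1 (hF n)),
    fun f hf => ?_⟩
  have hle : ∀ n : ℕ, supSum f ≤ cnorm g + ((n : ℝ≥0∞) + 1)⁻¹ := by
    intro n
    refine (supSum_mono (fun x hx => ?_)).trans (hFle n)
    by_cases h0 : f x = 0
    · simp [h0]
    · obtain ⟨hxN, hfx⟩ := hf x hx h0
      have : F n x = g x := by
        by_contra hc
        exact hxN (Set.mem_iUnion.2 ⟨n, hc⟩)
      rwa [this]
  refine ENNReal.le_of_forall_pos_le_add (fun ε hε _ => ?_)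
  obtain ⟨n, hn⟩ := ENNReal.exists_inv_nat_lt (a := (ε : ℝ≥0∞)) (by simpa using hε.ne')
  refine (hle n).trans (add_le_add le_rfl (le_trans ?_ hn.le))
  exact ENNReal.inv_le_inv.2 le_self_add

lemma exists_minimizer (g : Pt d →ₘ[volume] ℝ) :
    ∃ f : Pt d → ℝ, f =ᵐ[volume] g ∧ supSum f ≤ cnorm g := by
  classical
  obtain ⟨N, hN, h⟩ := exists_null_supSum_le g
  refine ⟨fun x => if x ∈ N then 0 else g x, ?_, h _ (fun x _ hx => ?_)⟩
  · filter_upwards [measure_eq_zero_iff_ae_notMem.1 hN] with x hx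
    simp [hx]
  · by_cases hxN : x ∈ N <;> simp_all

lemma cnorm_add_le (g h : Pt d →ₘ[volume] ℝ) : cnorm (g + h) ≤ cnorm g + cnorm h := by
  obtain ⟨f₁, h₁, hl₁⟩ := exists_minimizer g
  obtain ⟨f₂, h₂, hl₂⟩ := exists_minimizer h
  refine (cnorm_le_supSum (f := fun x => f₁ x + f₂ x) ?_).trans
    ((supSum_add_le f₁ f₂).trans (add_le_add hl₁ hl₂))
  filter_upwards [h₁, h₂, AEEqFun.coeFn_add g h] with x e₁ e₂ e
  rw [e, Pi.add_apply, e₁, e₂]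

lemma cnorm_neg_le (g : Pt d →ₘ[volume] ℝ) : cnorm (-g) ≤ cnorm g := by
  obtain ⟨f, h, hl⟩ := exists_minimizer g
  refine (cnorm_le_supSum (f := fun x => -f x) ?_).trans
    ((supSum_mono (fun x _ => by rw [abs_neg])).trans hl)
  filter_upwards [h, AEEqFun.coeFn_neg g] with x e₁ e
  rw [e, Pi.neg_apply, e₁]

lemma cnorm_zero : cnorm (0 : Pt d →ₘ[volume] ℝ) = 0 := by
  refine le_antisymm ((cnorm_le_supSum (f := fun _ => 0) ?_).trans ?_) zero_le
  · filter_upwards [AEEqFun.coeFn_zero (α := Pt d) (β := ℝ) (μ := volume)] with x hx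
    rw [hx, Pi.zero_apply]
  · simp [supSum]

lemma abs_le_of_supSum_le {f : Pt d → ℝ} {C : ℝ} (hC : 0 ≤ C) (h : supSum f ≤ ENNReal.ofReal C)
    {x : Pt d} (hx : 1 ≤ ‖x‖) : |f x| ≤ C := by
  have := (supSum_le_ofReal_iff hC).1 h {x} (isC0_singleton hx)
  simpa using this

lemma ae_abs_le_of_cnorm_le {g : Pt d →ₘ[volume] ℝ} {C : ℝ} (hC : 0 ≤ C)
    (h : cnorm g ≤ ENNReal.ofReal C) : ∀ᵐ x : Pt d, 1 ≤ ‖x‖ → |g x| ≤ C := by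
  obtain ⟨f, hf, hl⟩ := exists_minimizer g
  filter_upwards [hf] with x hfx hx
  rw [← hfx]
  exact abs_le_of_supSum_le hC (hl.trans h) hx

/-- A countable family of classes in `𝒢_1` has everywhere defined representatives that realize at
most the norms of the classes and of all their differences at the same time. -/
lemma exists_reps {J : Type} [Countable J] (u : J → Pt d →ₘ[volume] ℝ) (hu : ∀ j, IsG (u j))
    (hc : ∀ j, cnorm (u j) ≤ 1) :
    ∃ f : J → Pt d → ℝ, (∀ j, IsRep (f j)) ∧ (∀ j, f j =ᵐ[volume] u j) ∧
      (∀ j, supSum (f j) ≤ cnorm (u j)) ∧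
      ∀ i j, supSum (fun x => f i x - f j x) ≤ cnorm (u i - u j) := by
  classical
  choose N₁ hN₁ hl₁ using fun j => exists_null_supSum_le (u j)
  choose N₂ hN₂ hl₂ using fun i j => exists_null_supSum_le (u i - u j)
  have hgood : ∀ᵐ x : Pt d, (∀ j, x ∉ N₁ j ∧ (1 ≤ ‖x‖ → u j x = u j (-x)) ∧
      (‖x‖ < 1 → u j x = -1)) ∧ ∀ i j, x ∉ N₂ i j ∧ (u i - u j) x = u i x - u j x := by
    refine (ae_all_iff.2 (fun j => ?_)).and (ae_all_iff.2 (fun i => ae_all_iff.2 (fun j => ?_)))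
    · exact (measure_eq_zero_iff_ae_notMem.1 (hN₁ j)).and ((hu j).even.and (hu j).core)
    · exact (measure_eq_zero_iff_ae_notMem.1 (hN₂ i j)).and (AEEqFun.coeFn_sub (u i) (u j))
  set S : Set (Pt d) := toMeasurable volume {x | ¬ ((∀ j, x ∉ N₁ j ∧
      (1 ≤ ‖x‖ → u j x = u j (-x)) ∧ (‖x‖ < 1 → u j x = -1)) ∧
      ∀ i j, x ∉ N₂ i j ∧ (u i - u j) x = u i x - u j x)} with hS
  have hSm : MeasurableSet S := measurableSet_toMeasurable _ _
  have hS0 : volume S = 0 := by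
    rw [hS, measure_toMeasurable]
    exact ae_iff.1 hgood
  have hSgood : ∀ x, x ∉ S → (∀ j, x ∉ N₁ j ∧ (1 ≤ ‖x‖ → u j x = u j (-x)) ∧
      (‖x‖ < 1 → u j x = -1)) ∧ ∀ i j, x ∉ N₂ i j ∧ (u i - u j) x = u i x - u j x := by
    intro x hx
    by_contra hcon
    exact hx (subset_toMeasurable _ _ hcon)
  set T : Set (Pt d) := S ∪ (fun x => -x) ⁻¹' S with hT
  have hTm : MeasurableSet T := hSm.union (measurable_neg hSm)
  have hT0 : volume T = 0 := measure_union_null hS0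
    ((Measure.measurePreserving_neg (volume : Measure (Pt d))).quasiMeasurePreserving.preimage_null
      hS0)
  have hTneg : ∀ x, -x ∈ T ↔ x ∈ T := by
    intro x
    simp only [hT, Set.mem_union, Set.mem_preimage, neg_neg]
    exact or_comm
  set f : J → Pt d → ℝ := fun j x => if ‖x‖ < 1 then -1 else if x ∈ T then 0 else u j x with hf
  have hfT : ∀ j x, 1 ≤ ‖x‖ → x ∈ T → f j x = 0 := fun j x hx hxT => by
    simp [hf, not_lt.2 hx, hxT]
  have hfu : ∀ j x, 1 ≤ ‖x‖ → x ∉ T → f j x = u j x := fun j x hx hxT => by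
    simp [hf, not_lt.2 hx, hxT]
  have hTS : ∀ x, x ∉ T → x ∉ S := fun x hx hxS => hx (Or.inl hxS)
  have hle : ∀ j, supSum (f j) ≤ cnorm (u j) := by
    intro j
    refine hl₁ j _ (fun x hx h0 => ?_)
    have hxT : x ∉ T := fun h => h0 (hfT j x hx h)
    exact ⟨((hSgood x (hTS x hxT)).1 j).1, by rw [hfu j x hx hxT]⟩
  refine ⟨f, fun j => ⟨?_, fun x => ?_, fun x hx => by simp [hf, hx], ?_⟩, fun j => ?_, hle,
    fun i j => ?_⟩
  · exact Measurable.ite (measurableSet_lt measurable_norm measurable_const) measurable_const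
      (Measurable.ite hTm measurable_const (u j).measurable)
  · by_cases hx : ‖x‖ < 1
    · simp [hf, hx]
    · have hx' : 1 ≤ ‖x‖ := not_lt.1 hx
      have hxn : 1 ≤ ‖-x‖ := by rwa [norm_neg]
      by_cases hxT : x ∈ T
      · rw [hfT j x hx' hxT, hfT j (-x) hxn ((hTneg x).2 hxT)]
      · rw [hfu j x hx' hxT, hfu j (-x) hxn (fun h => hxT ((hTneg x).1 h))]
        exact (((hSgood x (hTS x hxT)).1 j).2.1 hx').symm
  · refine (supSum_le_ofReal_iff zero_le_one).1 ?_
    rw [ENNReal.ofReal_one]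
    exact (hle j).trans (hc j)
  · filter_upwards [measure_eq_zero_iff_ae_notMem.1 hT0] with x hxT
    by_cases hx : ‖x‖ < 1
    · rw [((hSgood x (hTS x hxT)).1 j).2.2 hx]
      simp [hf, hx]
    · exact hfu j x (not_lt.1 hx) hxT
  · refine hl₂ i j _ (fun x hx h0 => ?_)
    have hxT : x ∉ T := fun h => h0 (by rw [hfT i x hx h, hfT j x hx h, sub_zero])
    have hg := (hSgood x (hTS x hxT)).2 i j
    exact ⟨hg.1, by rw [hg.2, hfu i x hx hxT, hfu j x hx hxT]⟩

end Norm

/-! ### Dependence of the series on the representative, and their symmetry -/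

section Representatives

variable {d : ℕ} {f g : Pt d → ℝ}

lemma ae_pairwise_ofFn (h : f =ᵐ[volume] g) (n : ℕ) :
    ∀ᵐ y : Fin n → Pt d, (List.ofFn y).Pairwise (fun a b => f (a - b) = g (a - b)) := by
  simp only [List.pairwise_ofFn]
  refine ae_all_iff.2 (fun i => ae_all_iff.2 (fun j => ?_))
  by_cases hij : i < j
  · set L : (Fin n → Pt d) →ₗ[ℝ] Pt d :=
      LinearMap.proj (R := ℝ) (φ := fun _ : Fin n => Pt d) i - LinearMap.proj j with hL
    have hsurj : Function.Surjective L := fun v => ⟨Pi.single i v, by simp [hL, hij.ne]⟩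
    obtain ⟨c, _, hc⟩ := L.exists_map_addHaar_eq_smul_addHaar (volume : Measure (Fin n → Pt d))
      (volume : Measure (Pt d)) hsurj
    have hLm : Measurable L := L.continuous_of_finiteDimensional.measurable
    have hq : Measure.QuasiMeasurePreserving L volume volume :=
      ⟨hLm, by rw [hc]; exact Measure.smul_absolutelyContinuous⟩
    filter_upwards [hq.ae h] with y hy _
    simpa [hL] using hy
  · exact Filter.Eventually.of_forall (fun y h => absurd h hij)

lemma ae_eq_sub_apply (h : f =ᵐ[volume] g) (n : ℕ) (x : Pt d) :
    ∀ᵐ y : Fin n → Pt d, ∀ b ∈ List.ofFn y, f (x - b) = g (x - b) := by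
  simp only [List.forall_mem_ofFn_iff]
  refine ae_all_iff.2 (fun i => ?_)
  have h1 := (quasiMeasurePreserving_sub_left (volume : Measure (Pt d)) x).ae h
  exact (Measure.quasiMeasurePreserving_eval (fun _ : Fin n => (volume : Measure (Pt d))) i).ae h1

lemma ae_ursell_cons_eq (h : f =ᵐ[volume] g) (n : ℕ) (x : Pt d) :
    ∀ᵐ y : Fin n → Pt d, ursell f (x :: List.ofFn y) = ursell g (x :: List.ofFn y) := by
  filter_upwards [ae_pairwise_ofFn h n, ae_eq_sub_apply h n x] with y h1 h2
  exact ursell_congr (List.pairwise_cons.2 ⟨h2, h1⟩)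

lemma ae_ursell_cons_cons_eq (h : f =ᵐ[volume] g) (n : ℕ) {x x' : Pt d}
    (hx : f (x - x') = g (x - x')) :
    ∀ᵐ y : Fin n → Pt d, ursell f (x :: x' :: List.ofFn y) = ursell g (x :: x' :: List.ofFn y) := by
  filter_upwards [ae_pairwise_ofFn h n, ae_eq_sub_apply h n x, ae_eq_sub_apply h n x']
    with y h1 h2 h3
  refine ursell_congr (List.pairwise_cons.2 ⟨?_, List.pairwise_cons.2 ⟨h3, h1⟩⟩)
  intro b hb
  rcases List.mem_cons.1 hb with rfl | hb
  · exact hx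
  · exact h2 b hb

lemma seriesA_congr (h : f =ᵐ[volume] g) (z : ℝ) : seriesA z f = seriesA z g := by
  unfold seriesA
  refine tsum_congr (fun k => ?_)
  rw [integral_congr_ae (ae_ursell_cons_eq h (k + 1) 0)]

lemma ConvergesA.congr (h : f =ᵐ[volume] g) {z : ℝ} (hf : ConvergesA z f) : ConvergesA z g := by
  refine ⟨fun k => (hf.1 k).congr (ae_ursell_cons_eq h (k + 1) 0), hf.2.congr (fun k => ?_)⟩
  congr 1
  refine integral_congr_ae ?_
  filter_upwards [ae_ursell_cons_eq h (k + 1) 0] with y hy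
  rw [hy]

lemma seriesB_congr (h : f =ᵐ[volume] g) (z : ℝ) {x : Pt d} (hx : f (0 - x) = g (0 - x)) :
    seriesB z f x = seriesB z g x := by
  unfold seriesB
  refine tsum_congr (fun k => ?_)
  rw [integral_congr_ae (ae_ursell_cons_cons_eq h (k + 1) hx)]

lemma ConvergesB.congr (h : f =ᵐ[volume] g) {z : ℝ} {x : Pt d} (hx : f (0 - x) = g (0 - x))
    (hf : ConvergesB z f x) : ConvergesB z g x := by
  refine ⟨fun k => (hf.1 k).congr (ae_ursell_cons_cons_eq h (k + 1) hx), hf.2.congr (fun k => ?_)⟩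
  congr 1
  refine integral_congr_ae ?_
  filter_upwards [ae_ursell_cons_cons_eq h (k + 1) hx] with y hy
  rw [hy]

lemma ae_eq_zero_sub (h : f =ᵐ[volume] g) : ∀ᵐ x : Pt d, f (0 - x) = g (0 - x) :=
  (quasiMeasurePreserving_sub_left (volume : Measure (Pt d)) 0).ae h

lemma splitSum_map {α β : Type} {M : Type*} [AddCommMonoid M] (h : α → β) (X : List α)
    (F : List β → List β → M) :
    splitSum (X.map h) F = splitSum X (fun S T => F (S.map h) (T.map h)) := by
  induction X generalizing F with
  | nil => simp [splitSum_nil]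
  | cons a X ih => simp [splitSum_cons, ih]

lemma gammaInv_map {α β : Type} (h : α → β) (ψ : List β → ℝ) (X : List α) :
    gammaInv ψ (X.map h) = gammaInv (fun Y => ψ (Y.map h)) X := by
  have hone : ∀ Y : List α, (seqOne (Y.map h) : ℝ) = seqOne Y := fun Y => by
    cases Y <;> simp [seqOne]
  have hpow : ∀ k, ∀ Y : List α, seqPow (ψ - seqOne) k (Y.map h) =
      seqPow ((fun Y => ψ (Y.map h)) - seqOne) k Y := by
    intro k
    induction k with
    | zero => exact hone
    | succ k ih =>
      intro Y
      simp only [seqPow, seqMul_eq_splitSum, splitSum_map, ih, Pi.sub_apply, hone]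
  simp only [gammaInv, List.length_map, hpow]

lemma boltzmann_map_neg (hf : ∀ x, f (-x) = f x) (X : List (Pt d)) :
    boltzmann f (X.map (fun x => -x)) = boltzmann f X := by
  induction X with
  | nil => rfl
  | cons x X ih =>
    rw [List.map_cons, boltzmann_cons, boltzmann_cons, ih, List.map_map]
    congr 3
    funext y
    simp only [Function.comp_apply]
    rw [← neg_sub', hf]

lemma ursell_map_neg (hf : ∀ x, f (-x) = f x) (X : List (Pt d)) :
    ursell f (X.map (fun x => -x)) = ursell f X := by
  rw [ursell, gammaInv_map]
  congr 1
  funext Y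
  exact boltzmann_map_neg hf Y

lemma seriesB_neg (hf : ∀ x, f (-x) = f x) (z : ℝ) (x : Pt d) :
    seriesB z f (-x) = seriesB z f x := by
  unfold seriesB
  refine tsum_congr (fun k => ?_)
  congr 1
  have : (volume : Measure (Fin (k + 1) → Pt d)).IsNegInvariant :=
    Measure.pi.isNegInvariant (fun _ : Fin (k + 1) => (volume : Measure (Pt d)))
  rw [← integral_neg_eq_self]
  refine integral_congr_ae (Filter.Eventually.of_forall (fun y => ?_))
  have := ursell_map_neg hf (0 :: x :: List.ofFn y)
  simpa [List.map_ofFn, Function.comp_def] using this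

end Representatives

/-! ### The domain as a complete metric space -/

section Domain

open Filter Topology

variable {d : ℕ}

/-- The class of an everywhere defined function with the properties of the set `𝒢_c`. -/
lemma isG_mk {f : Pt d → ℝ} (hf : AEStronglyMeasurable f volume) (heven : ∀ x, f (-x) = f x)
    (hcore : ∀ x, ‖x‖ < 1 → f x = -1) {c : ℝ} (hc0 : 0 ≤ c) (hc1 : c < 1)
    (hle : supSum f ≤ ENNReal.ofReal c) :
    IsG (AEEqFun.mk f hf) ∧ cnorm (AEEqFun.mk f hf) ≤ ENNReal.ofReal c := by
  have hae := AEEqFun.coeFn_mk f hf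
  have hn : cnorm (AEEqFun.mk f hf) ≤ ENNReal.ofReal c := (cnorm_le_supSum hae.symm).trans hle
  refine ⟨⟨?_, ⟨c, hc1, ?_⟩, ?_, hn.trans_lt ENNReal.ofReal_lt_top⟩, hn⟩
  · have hneg :=
      (Measure.measurePreserving_neg (volume : Measure (Pt d))).quasiMeasurePreserving.ae hae
    filter_upwards [hae, hneg] with x h1 h2 _
    rw [h1, h2, heven]
  · filter_upwards [ae_abs_le_of_cnorm_le hc0 hn] with x h hx
    exact (abs_le.1 (h hx)).1
  · filter_upwards [hae] with x h hx
    rw [h, hcore x hx]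

variable {a₁ a₂ c h z₀ : ℝ}

lemma cnorm_sub_comm (g₁ g₂ : Pt d →ₘ[volume] ℝ) : cnorm (g₁ - g₂) = cnorm (g₂ - g₁) := by
  refine le_antisymm ?_ ?_
  · rw [← neg_sub g₂ g₁]
    exact cnorm_neg_le _
  · rw [← neg_sub g₁ g₂]
    exact cnorm_neg_le _

lemma rho_triangle (hh : 0 < h) (hz₀ : 0 < z₀) (p q s : ℝ × (Pt d →ₘ[volume] ℝ)) :
    rho h z₀ p s ≤ rho h z₀ p q + rho h z₀ q s := by
  have h1 : ENNReal.ofReal (h * |p.1 - s.1| / z₀) ≤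
      ENNReal.ofReal (h * |p.1 - q.1| / z₀) + ENNReal.ofReal (h * |q.1 - s.1| / z₀) := by
    rw [← ENNReal.ofReal_add (by positivity) (by positivity)]
    refine ENNReal.ofReal_le_ofReal ?_
    rw [← add_div, ← mul_add]
    gcongr
    exact abs_sub_le _ _ _
  have h2 : cnorm (p.2 - s.2) ≤ cnorm (p.2 - q.2) + cnorm (q.2 - s.2) := by
    have := cnorm_add_le (p.2 - q.2) (q.2 - s.2)
    rwa [sub_add_sub_cancel] at this
  calc rho h z₀ p s
      ≤ (ENNReal.ofReal (h * |p.1 - q.1| / z₀) + ENNReal.ofReal (h * |q.1 - s.1| / z₀)) +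
        (cnorm (p.2 - q.2) + cnorm (q.2 - s.2)) := add_le_add h1 h2
    _ = rho h z₀ p q + rho h z₀ q s := by
      unfold rho
      ring

lemma eq_of_rho_eq_zero (hh : 0 < h) (hz₀ : 0 < z₀) {p q : ℝ × (Pt d →ₘ[volume] ℝ)}
    (hp : IsG p.2) (hq : IsG q.2) (h0 : rho h z₀ p q = 0) : p = q := by
  obtain ⟨h1, h2⟩ := add_eq_zero.1 h0
  refine Prod.ext ?_ (AEEqFun.ext ?_)
  · have h3 : h * |p.1 - q.1| / z₀ ≤ 0 := ENNReal.ofReal_eq_zero.1 h1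
    have h4 : 0 < h / z₀ := by positivity
    have h5 : h / z₀ * |p.1 - q.1| ≤ 0 := by
      rw [div_mul_eq_mul_div]
      exact h3
    have h6 : |p.1 - q.1| ≤ 0 := nonpos_of_mul_nonpos_right h5 h4
    exact sub_eq_zero.1 (abs_nonpos_iff.1 h6)
  · have h3 := ae_abs_le_of_cnorm_le (C := 0) (g := p.2 - q.2) le_rfl (by rw [h2]; exact zero_le)
    filter_upwards [h3, hp.core, hq.core, AEEqFun.coeFn_sub p.2 q.2] with x h4 h5 h6 h7
    by_cases hx : ‖x‖ < 1
    · rw [h5 hx, h6 hx]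
    · have h8 := abs_nonpos_iff.1 (h4 (not_lt.1 hx))
      rw [h7, Pi.sub_apply] at h8
      exact sub_eq_zero.1 h8

lemma rho_lt_top {p q : ℝ × (Pt d →ₘ[volume] ℝ)} (hp : IsG p.2) (hq : IsG q.2) :
    rho h z₀ p q < ∞ := by
  refine ENNReal.add_lt_top.2 ⟨ENNReal.ofReal_lt_top, ?_⟩
  rw [sub_eq_add_neg]
  exact (cnorm_add_le _ _).trans_lt
    (ENNReal.add_lt_top.2 ⟨hp.finite, (cnorm_neg_le _).trans_lt hq.finite⟩)

/-- The domain `D` with the metric `ρ`. -/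
noncomputable abbrev domainSpace (d : ℕ) (a₁ a₂ c : ℝ) {h z₀ : ℝ} (hh : 0 < h) (hz₀ : 0 < z₀) :
    EMetricSpace (domainD d a₁ a₂ c z₀) where
  edist p q := rho h z₀ p.1 q.1
  edist_self p := by simp [rho, cnorm_zero]
  edist_comm p q := by
    simp only [rho]
    rw [abs_sub_comm, cnorm_sub_comm]
  edist_triangle p q s := rho_triangle hh hz₀ p.1 q.1 s.1
  eq_of_edist_eq_zero {p q} h0 := Subtype.ext (eq_of_rho_eq_zero hh hz₀ p.2.2.1 q.2.2.1 h0)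

/-- Completeness of `D`: representatives of a Cauchy sequence converge uniformly outside the core,
and the norm is lower semicontinuous under pointwise convergence. -/
lemma completeSpace_domainSpace (hh : 0 < h) (hz₀ : 0 < z₀) (hc0 : 0 ≤ c) (hc1 : c < 1) :
    letI := domainSpace d a₁ a₂ c hh hz₀
    CompleteSpace (domainD d a₁ a₂ c z₀) := by
  let _ := domainSpace d a₁ a₂ c hh hz₀
  have hB : Tendsto (fun n : ℕ => (1 / 2 : ℝ) ^ n) atTop (𝓝 0) :=
    tendsto_pow_atTop_nhds_zero_of_lt_one (by norm_num) (by norm_num)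
  refine EMetric.complete_of_convergent_controlled_sequences
    (fun n => ENNReal.ofReal ((1 / 2) ^ n)) (fun n => by positivity) (fun u hu => ?_)
  have hrho : ∀ N n m, N ≤ n → N ≤ m →
      rho h z₀ (u n).1 (u m).1 ≤ ENNReal.ofReal ((1 / 2) ^ N) :=
    fun N n m hn hm => (hu N n m hn hm).le
  -- the activities `z` form a Cauchy sequence in a closed interval
  have hz : ∀ n m N : ℕ, N ≤ n → N ≤ m →
      dist (u n).1.1 (u m).1.1 ≤ z₀ / h * (1 / 2) ^ N := by
    intro n m N hn hm
    have h1 : ENNReal.ofReal (h * |(u n).1.1 - (u m).1.1| / z₀) ≤ ENNReal.ofReal ((1 / 2) ^ N) :=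
      le_self_add.trans (hrho N n m hn hm)
    rw [ENNReal.ofReal_le_ofReal_iff (by positivity), div_le_iff₀ hz₀] at h1
    rw [Real.dist_eq, div_mul_eq_mul_div, le_div_iff₀ hh]
    linarith
  have hzB : Tendsto (fun n : ℕ => z₀ / h * (1 / 2 : ℝ) ^ n) atTop (𝓝 0) := by
    simpa using hB.const_mul (z₀ / h)
  obtain ⟨z, hzlim⟩ := cauchySeq_tendsto_of_complete (cauchySeq_of_le_tendsto_0 _ hz hzB)
  have hzmem : z ∈ Set.Icc (a₁ * z₀) (a₂ * z₀) :=
    isClosed_Icc.mem_of_tendsto hzlim (Eventually.of_forall (fun n => (u n).2.1))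
  -- one choice of representatives for all `n`, so that their differences are small at every point
  -- outside the core
  have hc1' : ENNReal.ofReal c ≤ 1 := by
    rw [← ENNReal.ofReal_one]
    exact ENNReal.ofReal_le_ofReal hc1.le
  obtain ⟨f, hrep, hae, hle, hdiff⟩ := exists_reps (fun n => (u n).1.2) (fun n => (u n).2.2.1)
    (fun n => (u n).2.2.2.trans hc1')
  have hsum : ∀ n m N : ℕ, N ≤ n → N ≤ m → ∀ X : Finset (Pt d), IsC0 X →
      ∑ x ∈ X, |f n x - f m x| ≤ (1 / 2) ^ N := by
    intro n m N hn hm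
    refine (supSum_le_ofReal_iff (by positivity)).1 ((hdiff n m).trans ?_)
    exact le_add_self.trans (hrho N n m hn hm)
  have hpt : ∀ x : Pt d, ∃ y, Tendsto (fun n => f n x) atTop (𝓝 y) := by
    intro x
    by_cases hx : ‖x‖ < 1
    · refine ⟨-1, ?_⟩
      simp only [(hrep _).core x hx]
      exact tendsto_const_nhds
    · refine cauchySeq_tendsto_of_complete (cauchySeq_of_le_tendsto_0 _ (fun n m N hn hm => ?_) hB)
      have := hsum n m N hn hm {x} (isC0_singleton (not_lt.1 hx))
      rwa [Finset.sum_singleton] at this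
  choose F hF using hpt
  have hFm : Measurable F :=
    measurable_of_tendsto_metrizable (fun n => (hrep n).meas) (tendsto_pi_nhds.2 hF)
  have hFeven : ∀ x, F (-x) = F x := fun x =>
    tendsto_nhds_unique ((hF (-x)).congr (fun n => (hrep n).even x)) (hF x)
  have hFcore : ∀ x, ‖x‖ < 1 → F x = -1 := by
    intro x hx
    refine tendsto_nhds_unique (hF x) ?_
    simp only [(hrep _).core x hx]
    exact tendsto_const_nhds
  have hFle : supSum F ≤ ENNReal.ofReal c := by
    refine (supSum_le_ofReal_iff hc0).2 (fun X hX => ?_)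
    refine le_of_tendsto (tendsto_finsetSum X (fun x _ => (hF x).abs))
      (Eventually.of_forall (fun n => ?_))
    exact (supSum_le_ofReal_iff hc0).1 ((hle n).trans (u n).2.2.2) X hX
  have hFdiff : ∀ n, supSum (fun x => f n x - F x) ≤ ENNReal.ofReal ((1 / 2) ^ n) := by
    intro n
    refine (supSum_le_ofReal_iff (by positivity)).2 (fun X hX => ?_)
    refine le_of_tendsto (tendsto_finsetSum X (fun x _ => ((hF x).const_sub (f n x)).abs)) ?_
    filter_upwards [eventually_ge_atTop n] with m hm
    exact hsum n m n le_rfl hm X hX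
  have hG := isG_mk hFm.aestronglyMeasurable hFeven hFcore hc0 hc1 hFle
  refine ⟨⟨(z, AEEqFun.mk F hFm.aestronglyMeasurable), hzmem, hG⟩, ?_⟩
  rw [tendsto_iff_edist_tendsto_0]
  have hbound : ∀ n, rho h z₀ (u n).1 (z, AEEqFun.mk F hFm.aestronglyMeasurable) ≤
      ENNReal.ofReal (h * |(u n).1.1 - z| / z₀) + ENNReal.ofReal ((1 / 2) ^ n) := by
    intro n
    refine add_le_add le_rfl ((cnorm_le_supSum ?_).trans (hFdiff n))
    filter_upwards [hae n, AEEqFun.coeFn_mk F hFm.aestronglyMeasurable,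
      AEEqFun.coeFn_sub (u n).1.2 (AEEqFun.mk F hFm.aestronglyMeasurable)] with x e1 e2 e3
    rw [e3, Pi.sub_apply, e1, e2]
  have hlim : Tendsto (fun n => ENNReal.ofReal (h * |(u n).1.1 - z| / z₀) +
      ENNReal.ofReal ((1 / 2) ^ n)) atTop (𝓝 0) := by
    have h1 : Tendsto (fun n => h * |(u n).1.1 - z| / z₀) atTop (𝓝 0) := by
      have := (((hzlim.sub_const z).abs).const_mul h).div_const z₀
      simpa using this
    have h2 := (ENNReal.tendsto_ofReal h1).add (ENNReal.tendsto_ofReal hB)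
    simpa using h2
  exact tendsto_of_tendsto_of_tendsto_of_le_of_le tendsto_const_nhds hlim (fun n => zero_le) hbound

lemma domainD_nonempty (hz₀ : 0 < z₀) (ha₁ : a₁ ≤ 1) (ha₂ : 1 ≤ a₂) (hc0 : 0 ≤ c) (hc1 : c < 1) :
    (domainD d a₁ a₂ c z₀).Nonempty := by
  classical
  have hm : Measurable (fun x : Pt d => if ‖x‖ < 1 then (-1 : ℝ) else 0) :=
    Measurable.ite (measurableSet_lt measurable_norm measurable_const) measurable_const
      measurable_const
  refine ⟨(z₀, AEEqFun.mk _ hm.aestronglyMeasurable), ⟨by nlinarith, by nlinarith⟩,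
    isG_mk hm.aestronglyMeasurable (fun x => by rw [norm_neg]) (fun x hx => if_pos hx) hc0 hc1 ?_⟩
  refine (supSum_le_ofReal_iff hc0).2 (fun X hX => ?_)
  rw [Finset.sum_eq_zero (fun x hx => by simp [not_lt.2 (hX.1 x hx)])]
  exact hc0

/-- The contraction principle on the domain `D`. -/
lemma exists_fixedPoint_of_contraction (hh : 0 < h) (hz₀ : 0 < z₀) (ha₁ : a₁ ≤ 1) (ha₂ : 1 ≤ a₂)
    (hc0 : 0 ≤ c) (hc1 : c < 1) {κ : ℝ≥0} (hκ : κ < 1)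
    {Q : ℝ × (Pt d →ₘ[volume] ℝ) → ℝ × (Pt d →ₘ[volume] ℝ)}
    (hmap : Set.MapsTo Q (domainD d a₁ a₂ c z₀) (domainD d a₁ a₂ c z₀))
    (hlip : ∀ p ∈ domainD d a₁ a₂ c z₀, ∀ q ∈ domainD d a₁ a₂ c z₀,
      rho h z₀ (Q p) (Q q) ≤ κ * rho h z₀ p q) :
    ∃ p ∈ domainD d a₁ a₂ c z₀, Q p = p := by
  let _ := domainSpace d a₁ a₂ c hh hz₀
  have := completeSpace_domainSpace (d := d) (a₁ := a₁) (a₂ := a₂) hh hz₀ hc0 hc1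
  obtain ⟨p₀, hp₀⟩ := domainD_nonempty (d := d) hz₀ ha₁ ha₂ hc0 hc1
  have hcontr : ContractingWith κ (hmap.restrict Q _ _) :=
    ⟨hκ, fun p q => hlip p.1 p.2 q.1 q.2⟩
  obtain ⟨p, hp, _⟩ := hcontr.exists_fixedPoint ⟨p₀, hp₀⟩ (rho_lt_top hp₀.2.1 (hmap hp₀).2.1).ne
  exact ⟨p.1, p.2, congrArg Subtype.val hp⟩

end Domain

/-! ### Estimates for the operator `Q` -/

section Operator

variable {d : ℕ}

lemma nextG_of_le {ω₂ : Pt d → ℝ} {z : ℝ} {f : Pt d → ℝ} {x : Pt d} (hx : 1 ≤ ‖x‖) :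
    nextG ω₂ z f x = ω₂ x / z ^ 2 - z * seriesB z f x := if_pos hx

lemma nextG_of_lt {ω₂ : Pt d → ℝ} {z : ℝ} {f : Pt d → ℝ} {x : Pt d} (hx : ‖x‖ < 1) :
    nextG ω₂ z f x = -1 := if_neg (not_le.2 hx)

lemma nextG_ae_eq {ω₂ : Pt d → ℝ} {z : ℝ} {f g : Pt d → ℝ} (h : f =ᵐ[volume] g) :
    nextG ω₂ z f =ᵐ[volume] nextG ω₂ z g := by
  filter_upwards [ae_eq_zero_sub h] with x hx
  simp only [nextG, seriesB_congr h z hx]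

lemma nextG_neg {ω₂ : Pt d → ℝ} (hω : ∀ x, ω₂ x = ω₂ (-x)) {z : ℝ} {f : Pt d → ℝ}
    (hf : ∀ x, f (-x) = f x) (x : Pt d) : nextG ω₂ z f (-x) = nextG ω₂ z f x := by
  simp only [nextG, norm_neg, seriesB_neg hf, ← hω x]

variable {K r a z₀ : ℝ} {ω₂ : Pt d → ℝ}

lemma SeriesBound.abs_fst_sub_le (hK : SeriesBound d K) {f : Pt d → ℝ} (hf : IsRep f) {z : ℝ}
    (hz0 : 0 < z) (hz : z ≤ 2 * z₀) (hr : 2 * z₀ ≤ seriesRadius d) :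
    |z ^ 2 * seriesA z f| ≤ 4 * K * z₀ ^ 2 := by
  have hzr : |z| ≤ seriesRadius d := by
    rw [abs_of_pos hz0]
    linarith
  have hA := (hK.2 f f hf hf z z hzr hzr).1
  have hK0 := hK.1
  rw [abs_mul, abs_pow, abs_of_pos hz0]
  calc z ^ 2 * |seriesA z f| ≤ (2 * z₀) ^ 2 * K := by gcongr
    _ = 4 * K * z₀ ^ 2 := by ring

lemma SeriesBound.supSum_nextG_le (hK : SeriesBound d K) {f : Pt d → ℝ} (hf : IsRep f) {z : ℝ}
    (ha : 0 < a) (hz₀ : 0 < z₀) (hz1 : a * z₀ ≤ z) (hz : z ≤ 2 * z₀)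
    (hr : 2 * z₀ ≤ seriesRadius d) (hr0 : 0 ≤ r)
    (hω : supSum ω₂ ≤ ENNReal.ofReal (r * z₀ ^ 2)) :
    supSum (nextG ω₂ z f) ≤ ENNReal.ofReal (r / a ^ 2 + 2 * K * z₀) := by
  have hz0 : 0 < z := lt_of_lt_of_le (by positivity) hz1
  have hzr : |z| ≤ seriesRadius d := by
    rw [abs_of_pos hz0]
    linarith
  have hK0 := hK.1
  have hB := (hK.2 f f hf hf z z hzr hzr).2.1
  rw [supSum_le_ofReal_iff (by positivity)] at hω
  refine (supSum_le_ofReal_iff (by positivity)).2 (fun X hX => ?_)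
  have hterm : ∀ x ∈ X, |nextG ω₂ z f x| ≤ |ω₂ x| / z ^ 2 + z * |seriesB z f x| := by
    intro x hx
    rw [nextG_of_le (hX.1 x hx)]
    refine (abs_sub _ _).trans (le_of_eq ?_)
    rw [abs_div, abs_mul, abs_of_pos hz0, abs_of_pos (by positivity : 0 < z ^ 2)]
  calc ∑ x ∈ X, |nextG ω₂ z f x|
      ≤ ∑ x ∈ X, (|ω₂ x| / z ^ 2 + z * |seriesB z f x|) := Finset.sum_le_sum hterm
    _ = (∑ x ∈ X, |ω₂ x|) / z ^ 2 + z * ∑ x ∈ X, |seriesB z f x| := by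
        rw [Finset.sum_add_distrib, Finset.sum_div, Finset.mul_sum]
    _ ≤ r * z₀ ^ 2 / (a * z₀) ^ 2 + 2 * z₀ * K := by
        gcongr
        · exact hω X hX
        · exact hB X hX
    _ = r / a ^ 2 + 2 * K * z₀ := by
        field_simp

lemma abs_inv_sq_sub_le {z₁ z₂ : ℝ} (ha : 0 < a) (hz₀ : 0 < z₀) (h₁ : a * z₀ ≤ z₁)
    (h₁' : z₁ ≤ 2 * z₀) (h₂ : a * z₀ ≤ z₂) (h₂' : z₂ ≤ 2 * z₀) :
    |1 / z₁ ^ 2 - 1 / z₂ ^ 2| ≤ 4 / (a ^ 4 * z₀ ^ 3) * |z₁ - z₂| := by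
  have hp : 0 < a * z₀ := by positivity
  have hz₁ : 0 < z₁ := lt_of_lt_of_le hp h₁
  have hz₂ : 0 < z₂ := lt_of_lt_of_le hp h₂
  have he : 1 / z₁ ^ 2 - 1 / z₂ ^ 2 = -((z₁ - z₂) * ((z₁ + z₂) / (z₁ ^ 2 * z₂ ^ 2))) := by
    field_simp
    ring
  rw [he, abs_neg, abs_mul, abs_of_pos (by positivity : 0 < (z₁ + z₂) / (z₁ ^ 2 * z₂ ^ 2)),
    mul_comm]
  refine mul_le_mul_of_nonneg_right ?_ (abs_nonneg _)
  calc (z₁ + z₂) / (z₁ ^ 2 * z₂ ^ 2)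
      ≤ (2 * z₀ + 2 * z₀) / ((a * z₀) ^ 2 * (a * z₀) ^ 2) := by gcongr
    _ = 4 / (a ^ 4 * z₀ ^ 3) := by
        field_simp
        ring

lemma SeriesBound.abs_fst_sub_fst_le (hK : SeriesBound d K) {f₁ f₂ : Pt d → ℝ} (hf₁ : IsRep f₁)
    (hf₂ : IsRep f₂) {z₁ z₂ ε : ℝ} (h₁ : 0 < z₁) (h₁' : z₁ ≤ 2 * z₀) (h₂ : 0 < z₂)
    (h₂' : z₂ ≤ 2 * z₀) (hr : 2 * z₀ ≤ seriesRadius d) (hε : 0 < ε)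
    (hd : ∀ X : Finset (Pt d), IsC0 X → ∑ x ∈ X, |f₁ x - f₂ x| ≤ ε) :
    |z₁ ^ 2 * seriesA z₁ f₁ - z₂ ^ 2 * seriesA z₂ f₂| ≤
      4 * K * z₀ ^ 2 * (|z₁ - z₂| + ε) + 4 * K * z₀ * |z₁ - z₂| := by
  have hK0 := hK.1
  have hr₁ : |z₁| ≤ seriesRadius d := by
    rw [abs_of_pos h₁]
    linarith
  have hr₂ : |z₂| ≤ seriesRadius d := by
    rw [abs_of_pos h₂]
    linarith
  have hA := ((hK.2 f₁ f₂ hf₁ hf₂ z₁ z₂ hr₁ hr₂).2.2 ε hε hd).1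
  have hA₂ := (hK.2 f₂ f₂ hf₂ hf₂ z₂ z₂ hr₂ hr₂).1
  have he : z₁ ^ 2 * seriesA z₁ f₁ - z₂ ^ 2 * seriesA z₂ f₂ =
      z₁ ^ 2 * (seriesA z₁ f₁ - seriesA z₂ f₂) + (z₁ + z₂) * (z₁ - z₂) * seriesA z₂ f₂ := by ring
  have hz₀ : 0 < z₀ := by linarith
  rw [he]
  refine (abs_add_le _ _).trans ?_
  rw [abs_mul, abs_mul, abs_mul, abs_pow, abs_of_pos h₁, abs_of_pos (add_pos h₁ h₂)]
  calc z₁ ^ 2 * |seriesA z₁ f₁ - seriesA z₂ f₂| + (z₁ + z₂) * |z₁ - z₂| * |seriesA z₂ f₂|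
      ≤ (2 * z₀) ^ 2 * (K * (|z₁ - z₂| + ε)) + (2 * z₀ + 2 * z₀) * |z₁ - z₂| * K := by gcongr
    _ = 4 * K * z₀ ^ 2 * (|z₁ - z₂| + ε) + 4 * K * z₀ * |z₁ - z₂| := by ring

lemma SeriesBound.supSum_nextG_sub_le (hK : SeriesBound d K) {f₁ f₂ : Pt d → ℝ} (hf₁ : IsRep f₁)
    (hf₂ : IsRep f₂) {z₁ z₂ ε : ℝ} (ha : 0 < a) (hz₀ : 0 < z₀) (h₁ : a * z₀ ≤ z₁)
    (h₁' : z₁ ≤ 2 * z₀) (h₂ : a * z₀ ≤ z₂) (h₂' : z₂ ≤ 2 * z₀) (hr : 2 * z₀ ≤ seriesRadius d)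
    (hr0 : 0 ≤ r) (hω : supSum ω₂ ≤ ENNReal.ofReal (r * z₀ ^ 2)) (hε : 0 < ε)
    (hd : ∀ X : Finset (Pt d), IsC0 X → ∑ x ∈ X, |f₁ x - f₂ x| ≤ ε) :
    supSum (fun x => nextG ω₂ z₁ f₁ x - nextG ω₂ z₂ f₂ x) ≤ ENNReal.ofReal
      (4 * r / (a ^ 4 * z₀) * |z₁ - z₂| + (2 * K * z₀ * (|z₁ - z₂| + ε) + K * |z₁ - z₂|)) := by
  have hK0 := hK.1
  have hp : 0 < a * z₀ := by positivity
  have hz₁ : 0 < z₁ := lt_of_lt_of_le hp h₁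
  have hz₂ : 0 < z₂ := lt_of_lt_of_le hp h₂
  have hr₁ : |z₁| ≤ seriesRadius d := by
    rw [abs_of_pos hz₁]
    linarith
  have hr₂ : |z₂| ≤ seriesRadius d := by
    rw [abs_of_pos hz₂]
    linarith
  have hB := ((hK.2 f₁ f₂ hf₁ hf₂ z₁ z₂ hr₁ hr₂).2.2 ε hε hd).2
  have hB₂ := (hK.2 f₂ f₂ hf₂ hf₂ z₂ z₂ hr₂ hr₂).2.1
  rw [supSum_le_ofReal_iff (by positivity)] at hω
  refine (supSum_le_ofReal_iff (by positivity)).2 (fun X hX => ?_)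
  have hterm : ∀ x ∈ X, |nextG ω₂ z₁ f₁ x - nextG ω₂ z₂ f₂ x| ≤
      |1 / z₁ ^ 2 - 1 / z₂ ^ 2| * |ω₂ x| + (z₁ * |seriesB z₁ f₁ x - seriesB z₂ f₂ x| +
        |z₁ - z₂| * |seriesB z₂ f₂ x|) := by
    intro x hx
    have he : nextG ω₂ z₁ f₁ x - nextG ω₂ z₂ f₂ x =
        (1 / z₁ ^ 2 - 1 / z₂ ^ 2) * ω₂ x - (z₁ * (seriesB z₁ f₁ x - seriesB z₂ f₂ x) +
          (z₁ - z₂) * seriesB z₂ f₂ x) := by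
      rw [nextG_of_le (hX.1 x hx), nextG_of_le (hX.1 x hx)]
      ring
    rw [he]
    refine (abs_sub _ _).trans (add_le_add (abs_mul _ _).le ((abs_add_le _ _).trans (le_of_eq ?_)))
    rw [abs_mul, abs_mul, abs_of_pos hz₁]
  calc ∑ x ∈ X, |nextG ω₂ z₁ f₁ x - nextG ω₂ z₂ f₂ x|
      ≤ ∑ x ∈ X, (|1 / z₁ ^ 2 - 1 / z₂ ^ 2| * |ω₂ x| +
          (z₁ * |seriesB z₁ f₁ x - seriesB z₂ f₂ x| + |z₁ - z₂| * |seriesB z₂ f₂ x|)) :=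
        Finset.sum_le_sum hterm
    _ = |1 / z₁ ^ 2 - 1 / z₂ ^ 2| * ∑ x ∈ X, |ω₂ x| +
          (z₁ * ∑ x ∈ X, |seriesB z₁ f₁ x - seriesB z₂ f₂ x| +
            |z₁ - z₂| * ∑ x ∈ X, |seriesB z₂ f₂ x|) := by
        simp only [Finset.sum_add_distrib, Finset.mul_sum]
    _ ≤ 4 / (a ^ 4 * z₀ ^ 3) * |z₁ - z₂| * (r * z₀ ^ 2) +
          (2 * z₀ * (K * (|z₁ - z₂| + ε)) + |z₁ - z₂| * K) := by
        gcongr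
        · exact abs_inv_sq_sub_le ha hz₀ h₁ h₁' h₂ h₂'
        · exact hω X hX
        · exact hB X hX
        · exact hB₂ X hX
    _ = 4 * r / (a ^ 4 * z₀) * |z₁ - z₂| +
          (2 * K * z₀ * (|z₁ - z₂| + ε) + K * |z₁ - z₂|) := by
        field_simp

/-- The bookkeeping of the contraction estimate: with `h = 16 / a⁴` the term from `ω₂ / z²`
contributes at most a quarter, and the other terms are of the order `K z₀`. -/
lemma contraction_arith {K r a z₀ Δ ε : ℝ} (hK : 0 ≤ K) (hr1 : r ≤ 1) (ha : 0 < a)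
    (ha1 : a ≤ 1) (hz₀ : 0 < z₀) (hz1 : z₀ ≤ 1) (hΔ : 0 ≤ Δ) (hε : 0 ≤ ε)
    (h1 : 11 * (K * z₀) ≤ 1 / 4) (h2 : (4 * (16 / a ^ 4) + 2) * (K * z₀) ≤ 1 / 2) :
    16 / a ^ 4 * (4 * K * z₀ ^ 2 * (Δ + ε) + 4 * K * z₀ * Δ) / z₀ +
      (4 * r / (a ^ 4 * z₀) * Δ + (2 * K * z₀ * (Δ + ε) + K * Δ)) ≤
      1 / 2 * (16 / a ^ 4 * Δ / z₀ + ε) := by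
  set H : ℝ := 16 / a ^ 4 with hH
  have hH1 : 1 ≤ H := by
    rw [hH, le_div_iff₀ (by positivity), one_mul]
    linarith [pow_le_one₀ (n := 4) ha.le ha1]
  set R : ℝ := H * Δ / z₀ with hR
  have hR0 : 0 ≤ R := by positivity
  have hΔR : Δ ≤ z₀ * R := by
    rw [hR, mul_div_cancel₀ _ hz₀.ne']
    nlinarith
  have e1 : H * (4 * K * z₀ ^ 2 * (Δ + ε) + 4 * K * z₀ * Δ) / z₀ =
      4 * (K * z₀) * z₀ * R + 4 * (K * z₀) * R + 4 * H * (K * z₀) * ε := by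
    rw [hR]
    field_simp
    ring
  have e2 : 4 * r / (a ^ 4 * z₀) * Δ = r / 4 * R := by
    rw [hR, hH]
    field_simp
    ring
  have hKz : 0 ≤ K * z₀ := by positivity
  have b1 : 4 * (K * z₀) * z₀ * R ≤ 4 * (K * z₀) * 1 * R := by gcongr
  have b2 : r / 4 * R ≤ 1 / 4 * R := by gcongr
  have b3 : K * Δ ≤ K * z₀ * R := by
    rw [mul_assoc]
    gcongr
  have b4 : 2 * K * z₀ * Δ ≤ 2 * (K * z₀) * (1 * R) := by
    rw [mul_assoc 2 K z₀]
    refine mul_le_mul_of_nonneg_left (hΔR.trans ?_) (by positivity)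
    gcongr
  have b5 : 11 * (K * z₀) * R ≤ 1 / 4 * R := mul_le_mul_of_nonneg_right h1 hR0
  have b6 : (4 * H + 2) * (K * z₀) * ε ≤ 1 / 2 * ε := mul_le_mul_of_nonneg_right h2 hε
  rw [e1, e2]
  linarith

end Operator

end HardCoreGibbs

open HardCoreGibbs
theorem mainTheorem2 (d : ℕ) (r : ℝ) (hr0 : 0 < r) (hr1 : r < 1) :
    ∃ a₁ a₂ c h : ℝ, ∃ κ : ℝ≥0,
      0 < a₁ ∧ a₁ < 1 ∧ 1 < a₂ ∧ 0 < c ∧ c < 1 ∧ 0 < h ∧ κ < 1 ∧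
      ∃ ε : ℝ, 0 < ε ∧ ∀ z₀ : ℝ, 0 < z₀ → z₀ < ε →
        -- the series that define `Q` converge absolutely on `D`
        (∀ p ∈ domainD d a₁ a₂ c z₀,
          ConvergesA p.1 p.2 ∧ ∀ᵐ x : Pt d, 1 ≤ ‖x‖ → ConvergesB p.1 p.2 x) ∧
        ∀ (ω₁ : ℝ) (ω₂ : Pt d → ℝ) (hω₂ : AEMeasurable ω₂ volume),
          ω₁ = z₀ →
          (∀ x, ‖x‖ < 1 → ω₂ x = -ω₁ ^ 2) →
          (∀ x, ω₂ x = ω₂ (-x)) →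
          supSum ω₂ ≤ ENNReal.ofReal (r * ω₁ ^ 2) →
          -- `Q` maps `D` into itself
          Set.MapsTo (opQ ω₁ ω₂ hω₂) (domainD d a₁ a₂ c z₀) (domainD d a₁ a₂ c z₀) ∧
          -- `Q` is a uniform contraction on `D`
          (∀ p ∈ domainD d a₁ a₂ c z₀, ∀ q ∈ domainD d a₁ a₂ c z₀,
            rho h z₀ (opQ ω₁ ω₂ hω₂ p) (opQ ω₁ ω₂ hω₂ q) ≤ κ * rho h z₀ p q) ∧
          -- `Q` has a fixed point in `D`
          ∃ p ∈ domainD d a₁ a₂ c z₀, opQ ω₁ ω₂ hω₂ p = p := by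
  obtain ⟨K, hK⟩ := exists_seriesBound d
  have hK0 : 0 ≤ K := hK.1
  obtain ⟨a, ha⟩ : ∃ a : ℝ, a = (1 + r) / 2 := ⟨_, rfl⟩
  have ha0 : 0 < a := by rw [ha]; linarith
  have ha1 : a < 1 := by rw [ha]; linarith
  -- the arithmetic mean `a` satisfies `a² > r`, which leaves room for the terms of order `z₀`
  have hra : r / a ^ 2 < 1 := by
    rw [div_lt_one (by positivity), ha]
    nlinarith [sq_pos_of_pos (sub_pos.2 hr1)]
  have hra0 : 0 < r / a ^ 2 := by positivity
  obtain ⟨c, hc⟩ : ∃ c : ℝ, c = (1 + r / a ^ 2) / 2 := ⟨_, rfl⟩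
  have hc0 : 0 < c := by rw [hc]; linarith
  have hc1 : c < 1 := by rw [hc]; linarith
  have hc1' : ENNReal.ofReal c ≤ 1 := by
    rw [← ENNReal.ofReal_one]
    exact ENNReal.ofReal_le_ofReal hc1.le
  have hH0 : 0 < 16 / a ^ 4 := by positivity
  -- `η` is the upper bound for `K z₀`: its terms serve the two components of the map into `D` and
  -- the two inequalities of `contraction_arith`
  obtain ⟨η, hη⟩ : ∃ η : ℝ, η = min (min ((1 - a) / 4) ((1 - r / a ^ 2) / 4))
    (min (1 / 44) (1 / (2 * (4 * (16 / a ^ 4) + 2)))) := ⟨_, rfl⟩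
  have hη0 : 0 < η := by
    rw [hη]
    refine lt_min (lt_min ?_ ?_) (lt_min (by norm_num) (by positivity))
    · linarith
    · linarith
  have hη1 : η ≤ (1 - a) / 4 := by
    rw [hη]
    exact (min_le_left _ _).trans (min_le_left _ _)
  have hη2 : η ≤ (1 - r / a ^ 2) / 4 := by
    rw [hη]
    exact (min_le_left _ _).trans (min_le_right _ _)
  have hη3 : η ≤ 1 / 44 := by
    rw [hη]
    exact (min_le_right _ _).trans (min_le_left _ _)
  have hη4 : (4 * (16 / a ^ 4) + 2) * η ≤ 1 / 2 := by
    have h5 : η ≤ 1 / (2 * (4 * (16 / a ^ 4) + 2)) := by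
      rw [hη]
      exact (min_le_right _ _).trans (min_le_right _ _)
    rw [le_div_iff₀ (by positivity)] at h5
    linarith
  have hrad := seriesRadius_pos d
  refine ⟨a, 2, c, 16 / a ^ 4, 1 / 2, ha0, ha1, one_lt_two, hc0, hc1, hH0, by norm_num,
    min 1 (min (seriesRadius d / 2) (η / (K + 1))), by positivity, fun z₀ hz₀ hlt => ?_⟩
  have hz1 : z₀ ≤ 1 := hlt.le.trans (min_le_left _ _)
  have hzr : 2 * z₀ ≤ seriesRadius d := by
    have := hlt.le.trans ((min_le_right _ _).trans (min_le_left _ _))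
    linarith
  have hKz : K * z₀ ≤ η := by
    have := hlt.le.trans ((min_le_right _ _).trans (min_le_right _ _))
    rw [le_div_iff₀ (by linarith)] at this
    nlinarith
  have hKz0 : 0 ≤ K * z₀ := by positivity
  have hfst : ∀ p ∈ domainD d a 2 c z₀, 0 < p.1 ∧ |p.1| ≤ seriesRadius d := by
    intro p hp
    have h0 : 0 < p.1 := lt_of_lt_of_le (by positivity) hp.1.1
    refine ⟨h0, ?_⟩
    rw [abs_of_pos h0]
    exact hp.1.2.trans hzr
  have hreps : ∀ p ∈ domainD d a 2 c z₀, ∃ f : Pt d → ℝ, IsRep f ∧ f =ᵐ[volume] p.2 := by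
    intro p hp
    obtain ⟨f, h1, h2, _⟩ := exists_reps (fun _ : Unit => p.2) (fun _ => hp.2.1)
      (fun _ => hp.2.2.trans hc1')
    exact ⟨f (), h1 (), h2 ()⟩
  refine ⟨fun p hp => ?_, fun ω₁ ω₂ hω₂ hω₁ _ heven hsup => ?_⟩
  · obtain ⟨f, hf, hfp⟩ := hreps p hp
    refine ⟨(hf.convergesA (hfst p hp).2).congr hfp, ?_⟩
    filter_upwards [ae_eq_zero_sub hfp] with x hx hx1
    exact (hf.convergesB (hfst p hp).2 hx1).congr hfp hx
  subst hω₁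
  have hmap : Set.MapsTo (opQ ω₁ ω₂ hω₂) (domainD d a 2 c ω₁) (domainD d a 2 c ω₁) := by
    intro p hp
    obtain ⟨f, hf, hfp⟩ := hreps p hp
    have hm : AEStronglyMeasurable (nextG ω₂ p.1 f) (volume : Measure (Pt d)) :=
      (aestronglyMeasurable_nextG hω₂ p.1 p.2).congr (nextG_ae_eq hfp).symm
    have hmk : (opQ ω₁ ω₂ hω₂ p).2 = AEEqFun.mk (nextG ω₂ p.1 f) hm :=
      AEEqFun.mk_eq_mk.2 (nextG_ae_eq hfp).symm
    have hle : supSum (nextG ω₂ p.1 f) ≤ ENNReal.ofReal c := by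
      refine (hK.supSum_nextG_le hf ha0 hz₀ hp.1.1 hp.1.2 hzr hr0.le hsup).trans
        (ENNReal.ofReal_le_ofReal ?_)
      rw [hc]
      linarith
    refine ⟨?_, ?_⟩
    · have h1 := hK.abs_fst_sub_le hf (hfst p hp).1 hp.1.2 hzr
      rw [seriesA_congr hfp] at h1
      have h2 : 4 * K * ω₁ ^ 2 ≤ (1 - a) * ω₁ := by nlinarith
      have h3 := abs_le.1 (h1.trans h2)
      simp only [opQ, Set.mem_Icc]
      constructor
      · linarith [h3.2]
      · nlinarith [h3.1]
    · rw [hmk]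
      exact isG_mk hm (nextG_neg heven hf.even) (fun x hx => nextG_of_lt hx) hc0.le hc1 hle
  have hlip : ∀ p ∈ domainD d a 2 c ω₁, ∀ q ∈ domainD d a 2 c ω₁,
      rho (16 / a ^ 4) ω₁ (opQ ω₁ ω₂ hω₂ p) (opQ ω₁ ω₂ hω₂ q) ≤
        ((1 / 2 : ℝ≥0) : ℝ≥0∞) * rho (16 / a ^ 4) ω₁ p q := by
    intro p hp q hq
    obtain ⟨f, hf, hfp, _, hfd⟩ := exists_reps (fun b : Bool => bif b then p.2 else q.2)
      (fun b => by cases b; exacts [hq.2.1, hp.2.1])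
      (fun b => by cases b; exacts [hq.2.2.trans hc1', hp.2.2.trans hc1'])
    have hp' : f true =ᵐ[volume] p.2 := hfp true
    have hq' : f false =ᵐ[volume] q.2 := hfp false
    have hd : supSum (fun x => f true x - f false x) ≤ cnorm (p.2 - q.2) := hfd true false
    have hfin : cnorm (p.2 - q.2) ≠ ∞ := by
      have := rho_lt_top (h := 16 / a ^ 4) (z₀ := ω₁) hp.2.1 hq.2.1
      exact (ENNReal.add_lt_top.1 this).2.ne
    obtain ⟨e, he⟩ : ∃ e : ℝ, e = (cnorm (p.2 - q.2)).toReal := ⟨_, rfl⟩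
    have he0 : 0 ≤ e := by rw [he]; exact ENNReal.toReal_nonneg
    have hee : cnorm (p.2 - q.2) = ENNReal.ofReal e := by rw [he, ENNReal.ofReal_toReal hfin]
    have hhalf : ((1 / 2 : ℝ≥0) : ℝ≥0∞) = ENNReal.ofReal (1 / 2) := by
      rw [← NNReal.coe_two, ← NNReal.coe_one, ← NNReal.coe_div, ENNReal.ofReal_coe_nnreal]
    have hrhs : ((1 / 2 : ℝ≥0) : ℝ≥0∞) * rho (16 / a ^ 4) ω₁ p q =
        ENNReal.ofReal (1 / 2 * (16 / a ^ 4 * |p.1 - q.1| / ω₁ + e)) := by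
      rw [rho, hee, ← ENNReal.ofReal_add (by positivity) he0, hhalf,
        ← ENNReal.ofReal_mul (by norm_num)]
    rw [hrhs]
    -- the estimate for differences needs a positive bound of the norm, any `ε > e`
    refine ENNReal.le_of_forall_pos_le_add (fun δ hδ _ => ?_)
    have hδ' : (0 : ℝ) < δ := hδ
    have hdε : ∀ X : Finset (Pt d), IsC0 X → ∑ x ∈ X, |f true x - f false x| ≤ e + δ := by
      refine (supSum_le_ofReal_iff (by positivity)).1 (hd.trans ?_)
      rw [hee]
      exact ENNReal.ofReal_le_ofReal (by linarith)
    have hA := hK.abs_fst_sub_fst_le (hf true) (hf false) (hfst p hp).1 hp.1.2 (hfst q hq).1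
      hq.1.2 hzr (by positivity : 0 < e + δ) hdε
    rw [seriesA_congr hp', seriesA_congr hq'] at hA
    have hB := hK.supSum_nextG_sub_le (hf true) (hf false) ha0 hz₀ hp.1.1 hp.1.2 hq.1.1 hq.1.2
      hzr hr0.le hsup (by positivity : 0 < e + δ) hdε
    have hfst' : |(opQ ω₁ ω₂ hω₂ p).1 - (opQ ω₁ ω₂ hω₂ q).1| ≤
        4 * K * ω₁ ^ 2 * (|p.1 - q.1| + (e + δ)) + 4 * K * ω₁ * |p.1 - q.1| := by
      refine le_trans (le_of_eq ?_) hA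
      simp only [opQ]
      rw [abs_sub_comm]
      congr 1
      ring
    have hsnd' : cnorm ((opQ ω₁ ω₂ hω₂ p).2 - (opQ ω₁ ω₂ hω₂ q).2) ≤
        supSum (fun x => nextG ω₂ p.1 (f true) x - nextG ω₂ q.1 (f false) x) := by
      refine cnorm_le_supSum ?_
      filter_upwards [AEEqFun.coeFn_sub (opQ ω₁ ω₂ hω₂ p).2 (opQ ω₁ ω₂ hω₂ q).2,
        AEEqFun.coeFn_mk _ (aestronglyMeasurable_nextG hω₂ p.1 p.2),
        AEEqFun.coeFn_mk _ (aestronglyMeasurable_nextG hω₂ q.1 q.2),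
        nextG_ae_eq (ω₂ := ω₂) (z := p.1) hp', nextG_ae_eq (ω₂ := ω₂) (z := q.1) hq']
        with x e1 e2 e3 e4 e5
      rw [e1, Pi.sub_apply, e4, e5]
      exact (congrArg₂ (· - ·) e2 e3).symm
    calc rho (16 / a ^ 4) ω₁ (opQ ω₁ ω₂ hω₂ p) (opQ ω₁ ω₂ hω₂ q)
        ≤ ENNReal.ofReal (16 / a ^ 4 *
              (4 * K * ω₁ ^ 2 * (|p.1 - q.1| + (e + δ)) + 4 * K * ω₁ * |p.1 - q.1|) / ω₁) +
            ENNReal.ofReal (4 * r / (a ^ 4 * ω₁) * |p.1 - q.1| +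
              (2 * K * ω₁ * (|p.1 - q.1| + (e + δ)) + K * |p.1 - q.1|)) := by
          refine add_le_add (ENNReal.ofReal_le_ofReal ?_) (hsnd'.trans hB)
          gcongr
      _ ≤ ENNReal.ofReal (1 / 2 * (16 / a ^ 4 * |p.1 - q.1| / ω₁ + (e + δ))) := by
          rw [← ENNReal.ofReal_add (by positivity) (by positivity)]
          refine ENNReal.ofReal_le_ofReal (contraction_arith hK0 hr1.le ha0 ha1.le hz₀ hz1
            (abs_nonneg _) (by positivity) (by linarith) (le_trans ?_ hη4))
          gcongr
      _ ≤ ENNReal.ofReal (1 / 2 * (16 / a ^ 4 * |p.1 - q.1| / ω₁ + e)) + δ := by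
          rw [← ENNReal.ofReal_coe_nnreal (p := δ), ← ENNReal.ofReal_add (by positivity) hδ'.le]
          refine ENNReal.ofReal_le_ofReal ?_
          linarith
  exact ⟨hmap, hlip, exists_fixedPoint_of_contraction hH0 hz₀ ha1.le one_le_two hc0.le hc1
    (by norm_num : (1 / 2 : ℝ≥0) < 1) hmap hlip⟩
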